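/- **Theorem 3.4 (Abstract Density Theorem).** *Setting.* Let $H$ be a separable Hilbert space, $I$ a countable set, and $G=\prod_{i=1}^d \alpha_i\mathbf Z\times\prod_{l=1}^e \mathbf Z_{n_l}$ with $d\ge 1$, $e\ge 0$, $\alpha_i>0$, $n_l\ge 1$, equipped with $|g|=\sup\{|\alpha_1k_1|,\dots,|\alpha_dk_d|,\delta(m_1),\dots,\delta(m_e)\}$ for $g=(\alpha_1k_1,\dots,\alpha_dk_d,m_1,\dots,m_e)$, where $\delta(0)=0$ and $\delta(m)=1$ for $m\ne 0$. Let $a\colon I\to G$ be a map, and for $N\in\mathbf N$, $j\in G$ put $S_N(j)=\{k\in G:|k-j|\le N/2\}$ and $I_N(j)=a^{-1}(S_N(j))$. Define $$D^-(I,a)=\liminf_{N\to\infty}\inf_{j\in G}\frac{|I_N(j)|}{|S_N(j)|},\qquad D^+(I,a)=\limsup_{N\to\infty}\sup_{j\in G}\frac{|I_N(j)|}{|S_N(j)|},$$ and, for a free ultrafilter $p$ on $\mathbf N$ and a sequence of centers $c=(c_N)_{N\in\mathbf N}$ in $G$, $$D(p,c)=\operatorname*{p\text{-}lim}_{N}\frac{|I_N(c_N)|}{|S_N(c_N)|}.$$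 A family $\mathcal F=\{f_i\}_{i\in I}$ in $H$ is a frame for $H$ if there are $A,B>0$ with $A\|f\|^2\le\sum_{i}|\langle f,f_i\rangle|^2\le B\|f\|^2$ for all $f\in H$; its canonical dual frame is $\tilde f_i=S^{-1}f_i$, where $Sf=\sum_i\langle f,f_i\rangle f_i$ (then $0\le\langle f_i,\tilde f_i\rangle\le 1$). A family is a Riesz basis for $H$ if it is the image of an orthonormal basis of $H$ under a continuous invertible linear map. The measures of a frame $\mathcal F=\{f_i\}_{i\in I}$ are $$\mathcal M(\mathcal F;p,c)=\operatorname*{p\text{-}lim}_{N}\frac1{|I_N(c_N)|}\sum_{i\in I_N(c_N)}\langle f_i,\tilde f_i\rangle,$$ $$\mathcal M^-(\mathcal F)=\liminf_{N\to\infty}\inf_{j\in G}\frac1{|I_N(j)|}\sum_{i\in I_N(j)}\langle f_i,\tilde f_i\rangle,\qquad \mathcal M^+(\mathcal F)=\limsup_{N\to\infty}\sup_{j\in G}\frac1{|I_N(j)|}\sum_{i\in I_N(j)}\langle f_i,\tilde f_i\rangle,$$ where an average over an empty set is read as $0$. For a frame $\mathcal E=\{e_j\}_{j\in G}$ the measures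 are defined in the same way with $S_N$ in place of $I_N$. *Statement.* Let $\mathcal F=\{f_i\}_{i\in I}$ and $\mathcal E=\{e_j\}_{j\in G}$ be frames for $H$ and suppose $D^+(I,a)<\infty$. Suppose that $(\mathcal F,a,\mathcal E)$ has $\ell^2$-column decay and $\ell^2$-row decay, i.e. for every $\varepsilon>0$ there is an integer $N_\varepsilon>0$ with $\sum_{i\in I\setminus I_{N_\varepsilon}(j)}|\langle f_i,e_j\rangle|^2<\varepsilon$ for all $j\in G$, and for every $\varepsilon>0$ there is an integer $N_\varepsilon>0$ with $\sum_{j\in G\setminus S_{N_\varepsilon}(a(i))}|\langle f_i,e_j\rangle|^2<\varepsilon$ for all $i\in I$. Then: (a) For each free ultrafilter $p$ and each sequence of centers $c$ in $G$, $$\mathcal M(\mathcal E;p,c)=D(p,c)\cdot\mathcal M(\mathcal F;p,c).$$ Moreover, $$\mathcal M^-(\mathcal E)\le D^+(I,a)\cdot\mathcal M^-(\mathcal F)\le\mathcal M^+(\mathcal E),\qquad \mathcal M^-(\mathcal E)\le D^-(I,a)\cdot\mathcal M^+(\mathcal F)\le\mathcal M^+(\mathcal E).$$ (b) If $D^+(I,a)>\mathcal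 M^+(\mathcal E)$, then there is an infinite set $J\subset I$ such that $\{f_i\}_{i\in I\setminus J}$ is still a frame for $H$. If $\mathcal E$ is a Riesz basis for $H$, then in addition: (c) For each free ultrafilter $p$ and each sequence of centers $c$ in $G$, $$\mathcal M(\mathcal F;p,c)=\frac1{D(p,c)},\qquad \mathcal M^-(\mathcal F)=\frac1{D^+(I,a)},\qquad \mathcal M^+(\mathcal F)=\frac1{D^-(I,a)}.$$ (d) $D^-(I,a)\ge 1$. (e) If $D^+(I,a)>1$, then there is an infinite set $J\subset I$ such that $\{f_i\}_{i\in I\setminus J}$ is still a frame for $H$. (f) If $\mathcal F$ is also a Riesz basis for $H$, then for each free ultrafilter $p$ and each sequence of centers $c$ in $G$, $$D^-(I,a)=D(p,c)=D^+(I,a)=1,\qquad \mathcal M^-(\mathcal F)=\mathcal M(\mathcal F;p,c)=\mathcal M^+(\mathcal F)=1.$$ -/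

import Mathlib

open scoped ENNReal

noncomputable section

namespace FrameDensity

/-! ### The reference group and its boxes -/

/-- The group `G = ∏_{i=1}^d α_i ℤ × ∏_{l=1}^e ℤ_{n_l}`. An element
`(α_1 k_1, …, α_d k_d, m_1, …, m_e)` is recorded by `(k_1, …, k_d)` and `(m_1, …, m_e)`; the
spacings `α_i` enter through the size function below. -/
abbrev RefGroup (d : ℕ) {e : ℕ} (n : Fin e → ℕ) : Type :=
  (Fin d → ℤ) × ((l : Fin e) → ZMod (n l))

/-- `|g| = sup {|α_1 k_1|, …, |α_d k_d|, δ(m_1), …, δ(m_e)}` with `δ(0) = 0` and `δ(m) = 1` for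
`m ≠ 0`. (An empty real supremum is `0` in Mathlib.) -/
def size {d e : ℕ} {n : Fin e → ℕ} (α : Fin d → ℝ) (g : RefGroup d n) : ℝ :=
  max (⨆ i, |α i * (g.1 i : ℝ)|) (⨆ l, if g.2 l = 0 then (0 : ℝ) else 1)

/-- The box `S_N(j) = {k ∈ G : |k - j| ≤ N / 2}`. -/
def box {d e : ℕ} {n : Fin e → ℕ} (α : Fin d → ℝ) (N : ℕ) (j : RefGroup d n) :
    Set (RefGroup d n) :=
  {k | size α (k - j) ≤ (N : ℝ) / 2}

/-- `I_N(j) = a⁻¹(S_N(j))`. -/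
def preBox {d e : ℕ} {n : Fin e → ℕ} {I : Type*} (α : Fin d → ℝ) (a : I → RefGroup d n)
    (N : ℕ) (j : RefGroup d n) : Set I :=
  a ⁻¹' box α N j

/-! ### Densities -/

/-- `|I_N(j)| / |S_N(j)|`, equal to `∞` when `I_N(j)` is infinite. -/
def boxDensity {d e : ℕ} {n : Fin e → ℕ} {I : Type*} (α : Fin d → ℝ) (a : I → RefGroup d n)
    (N : ℕ) (j : RefGroup d n) : ℝ≥0∞ :=
  ((preBox α a N j).encard : ℝ≥0∞) / ((box α N j).encard : ℝ≥0∞)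

/-- The lower density `D⁻(I, a)`. -/
def lowerDensity {d e : ℕ} {n : Fin e → ℕ} {I : Type*} (α : Fin d → ℝ)
    (a : I → RefGroup d n) : ℝ≥0∞ :=
  Filter.liminf (fun N : ℕ => ⨅ j, boxDensity α a N j) Filter.atTop

/-- The upper density `D⁺(I, a)`. -/
def upperDensity {d e : ℕ} {n : Fin e → ℕ} {I : Type*} (α : Fin d → ℝ)
    (a : I → RefGroup d n) : ℝ≥0∞ :=
  Filter.limsup (fun N : ℕ => ⨆ j, boxDensity α a N j) Filter.atTop

/-- An ultrafilter on `ℕ` is free if it contains every cofinite set. -/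
def IsFree (p : Ultrafilter ℕ) : Prop :=
  (p : Filter ℕ) ≤ Filter.cofinite

/-- The limit along the ultrafilter `p` of a sequence in `[0, ∞]`. It always exists and is unique,
`[0, ∞]` being compact and Hausdorff. -/
def pLim (p : Ultrafilter ℕ) (u : ℕ → ℝ≥0∞) : ℝ≥0∞ :=
  (p : Filter ℕ).limUnder u

/-- `pLim` is the limit along `p`. -/
theorem tendsto_pLim (p : Ultrafilter ℕ) (u : ℕ → ℝ≥0∞) :
    Filter.Tendsto u (p : Filter ℕ) (nhds (pLim p u)) := by
  obtain ⟨x, -, hx⟩ := isCompact_univ.ultrafilter_le_nhds (p.map u) (by simp)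
  exact tendsto_nhds_limUnder ⟨x, hx⟩

/-- The density `D(p, c) = D(p, c; I, a)`. -/
def density {d e : ℕ} {n : Fin e → ℕ} {I : Type*} (α : Fin d → ℝ) (a : I → RefGroup d n)
    (p : Ultrafilter ℕ) (c : ℕ → RefGroup d n) : ℝ≥0∞ :=
  pLim p (fun N => boxDensity α a N (c N))

/-! ### Frames, Riesz bases and canonical duals -/

section Frames

variable (𝕜 : Type*) [RCLike 𝕜] {H : Type*} [NormedAddCommGroup H] [InnerProductSpace 𝕜 H]

/-- `f` is a frame for `H`: there are `A, B > 0` with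
`A ‖x‖² ≤ ∑_i |⟨x, f_i⟩|² ≤ B ‖x‖²` for all `x`. -/
def IsFrame {ι : Type*} (f : ι → H) : Prop :=
  ∃ A B : ℝ, 0 < A ∧ 0 < B ∧ ∀ x : H,
    ENNReal.ofReal (A * ‖x‖ ^ 2) ≤ ∑' i, ‖inner 𝕜 (f i) x‖ₑ ^ 2 ∧
    ∑' i, ‖inner 𝕜 (f i) x‖ₑ ^ 2 ≤ ENNReal.ofReal (B * ‖x‖ ^ 2)

/-- `f` is a Riesz basis for `H`: the image of an orthonormal basis of `H` under a continuous
invertible linear map. -/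
def IsRieszBasis {ι : Type*} (f : ι → H) : Prop :=
  ∃ (b : HilbertBasis ι 𝕜 H) (T : H ≃L[𝕜] H), ∀ i, f i = T (b i)

/-- The frame operator `S x = ∑_i ⟨x, f_i⟩ f_i`. For a frame the series converges
unconditionally and `S` is a bijection of `H`. -/
def frameOp {ι : Type*} (f : ι → H) (x : H) : H :=
  ∑' i, inner 𝕜 (f i) x • f i

/-- The canonical dual frame `f̃_i = S⁻¹ f_i`. -/
def canonicalDual {ι : Type*} (f : ι → H) (i : ι) : H :=
  Function.invFun (frameOp 𝕜 f) (f i)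

/-- The number `⟨f_i, f̃_i⟩`. For a frame it equals `⟨f_i, S⁻¹ f_i⟩`, which is real and lies in
`[0, 1]`, so that nothing is lost by recording its real part in `[0, ∞]`. -/
def dualPairing {ι : Type*} (f : ι → H) (i : ι) : ℝ≥0∞ :=
  ENNReal.ofReal (RCLike.re (inner 𝕜 (canonicalDual 𝕜 f i) (f i)))

/-! ### Localization -/

variable {d e : ℕ} {n : Fin e → ℕ} {I : Type*}

/-- `(F, a, E)` has `ℓ²`-column decay. -/
def ColumnDecay (α : Fin d → ℝ) (a : I → RefGroup d n) (f : I → H)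
    (g : RefGroup d n → H) : Prop :=
  ∀ ε : ℝ, 0 < ε → ∃ N : ℕ, 0 < N ∧ ∀ j : RefGroup d n,
    ∑' i : ↥(preBox α a N j)ᶜ, ‖inner 𝕜 (g j) (f i)‖ₑ ^ 2 < ENNReal.ofReal ε

/-- `(F, a, E)` has `ℓ²`-row decay. -/
def RowDecay (α : Fin d → ℝ) (a : I → RefGroup d n) (f : I → H)
    (g : RefGroup d n → H) : Prop :=
  ∀ ε : ℝ, 0 < ε → ∃ N : ℕ, 0 < N ∧ ∀ i : I,
    ∑' j : ↥(box α N (a i))ᶜ, ‖inner 𝕜 (g j) (f i)‖ₑ ^ 2 < ENNReal.ofReal ε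

/-! ### Measures of a frame

The measures of a frame `E` indexed by the reference group itself are those for `a = id`, for
which `I_N(j) = S_N(j)`. -/

/-- The average `|I_N(j)|⁻¹ ∑_{i ∈ I_N(j)} ⟨f_i, f̃_i⟩`; it is `0` if `I_N(j)` is empty. -/
def boxAverage (α : Fin d → ℝ) (a : I → RefGroup d n) (f : I → H) (N : ℕ)
    (j : RefGroup d n) : ℝ≥0∞ :=
  (∑' i : ↥(preBox α a N j), dualPairing 𝕜 f i) / ((preBox α a N j).encard : ℝ≥0∞)

/-- The measure `M(F; p, c)`. -/
def frameMeasure (α : Fin d → ℝ) (a : I → RefGroup d n) (f : I → H)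
    (p : Ultrafilter ℕ) (c : ℕ → RefGroup d n) : ℝ≥0∞ :=
  pLim p (fun N => boxAverage 𝕜 α a f N (c N))

/-- The lower measure `M⁻(F)`. -/
def lowerMeasure (α : Fin d → ℝ) (a : I → RefGroup d n) (f : I → H) : ℝ≥0∞ :=
  Filter.liminf (fun N : ℕ => ⨅ j, boxAverage 𝕜 α a f N j) Filter.atTop

/-- The upper measure `M⁺(F)`. -/
def upperMeasure (α : Fin d → ℝ) (a : I → RefGroup d n) (f : I → H) : ℝ≥0∞ :=
  Filter.limsup (fun N : ℕ => ⨆ j, boxAverage 𝕜 α a f N j) Filter.atTop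

end Frames

end FrameDensity

end

open FrameDensity

/-!
Put `t i k = ⟨f_i, e_k⟩ ⟨ẽ_k, f̃_i⟩`. Summing over `k` gives `⟨f_i, f̃_i⟩`, summing over `i` gives
`⟨ẽ_k, e_k⟩`. By the two decay conditions the mass of `t` sits near `k = a i`, uniformly in `i` and
`k`, so the sums of `⟨f_i, f̃_i⟩` over `I_N(j)` and of `⟨ẽ_k, e_k⟩` over `S_N(j)` differ only by
what `t` carries across the boundary of the box, which is `o(|S_N(j)|)` uniformly in `j`. Dividing
by `|S_N(j)|` and passing to limits along free ultrafilters gives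
`M(E; p, c) = D(p, c) M(F; p, c)`, and every upper or lower limit is attained along some `p` and
`c`.

If a measure of `F` is less than `1`, infinitely many `⟨f_i, f̃_i⟩` stay below some `L < 1`. The
vectors `(⟨f̃_i, f_k⟩)_k` are the projections of the standard basis vectors onto the range of the
analysis operator, so a sufficiently sparse infinite set of such `i` can be removed.
-/

namespace FrameDensity

open Filter Topology Asymptotics
open scoped NNReal

/-! ### Bessel sequences and the frame operator -/

section Frames

variable {𝕜 : Type*} [RCLike 𝕜] {H : Type*} [NormedAddCommGroup H] [InnerProductSpace 𝕜 H]
  {ι κ : Type*} {f : ι → H} {g : κ → H}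

variable (𝕜) in
/-- `f` is a Bessel sequence: it satisfies the upper frame inequality. -/
def IsBessel (f : ι → H) : Prop :=
  ∃ B : ℝ≥0, ∀ x : H, ∑' i, ‖inner 𝕜 (f i) x‖ₑ ^ 2 ≤ B * ‖x‖ₑ ^ 2

theorem isFrame_iff : IsFrame 𝕜 f ↔ ∃ A B : ℝ≥0, 0 < A ∧ ∀ x : H,
    A * ‖x‖ₑ ^ 2 ≤ ∑' i, ‖inner 𝕜 (f i) x‖ₑ ^ 2 ∧
    ∑' i, ‖inner 𝕜 (f i) x‖ₑ ^ 2 ≤ B * ‖x‖ₑ ^ 2 := by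
  have ofReal_mul_norm_sq (c : ℝ) (hc : 0 ≤ c) (x : H) :
      ENNReal.ofReal (c * ‖x‖ ^ 2) = ENNReal.ofReal c * ‖x‖ₑ ^ 2 := by
    rw [ENNReal.ofReal_mul hc, ENNReal.ofReal_pow (norm_nonneg x), ofReal_norm]
  constructor
  · rintro ⟨A, B, hA, hB, h⟩
    refine ⟨A.toNNReal, B.toNNReal, Real.toNNReal_pos.2 hA, fun x => ?_⟩
    have hx := h x
    rwa [ofReal_mul_norm_sq _ hA.le, ofReal_mul_norm_sq _ hB.le] at hx
  · rintro ⟨A, B, hA, h⟩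
    refine ⟨A, B + 1, hA, by positivity, fun x => ⟨?_, (h x).2.trans ?_⟩⟩
    · simpa only [ofReal_mul_norm_sq _ A.coe_nonneg, ENNReal.ofReal_coe_nnreal] using (h x).1
    · rw [ofReal_mul_norm_sq _ (by positivity)]
      gcongr
      rw [← ENNReal.ofReal_coe_nnreal]
      exact ENNReal.ofReal_le_ofReal (by linarith)

theorem IsFrame.isBessel (hf : IsFrame 𝕜 f) : IsBessel 𝕜 f := by
  obtain ⟨A, B, -, h⟩ := isFrame_iff.1 hf
  exact ⟨B, fun x => (h x).2⟩

theorem lp_enorm_sq (c : lp (fun _ : ι => 𝕜) 2) : ‖c‖ₑ ^ 2 = ∑' i, ‖c i‖ₑ ^ 2 := by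
  have summable_sq : Summable fun i => ‖c i‖ ^ 2 := by
    simpa using (lp.memℓp c).summable (by norm_num)
  have norm_sq : ‖c‖ ^ 2 = ∑' i, ‖c i‖ ^ 2 := by
    simpa using lp.norm_rpow_eq_tsum (p := 2) (by norm_num) c
  simp_rw [← ofReal_norm, ← ENNReal.ofReal_pow (norm_nonneg _), norm_sq]
  exact ENNReal.ofReal_tsum_of_nonneg (fun _ => by positivity) summable_sq

theorem IsBessel.memℓp_inner (hf : IsBessel 𝕜 f) (x : H) : Memℓp (fun i => inner 𝕜 (f i) x) 2 := by
  obtain ⟨B, hB⟩ := hf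
  refine memℓp_gen ?_
  simpa using ENNReal.summable_toReal (ne_top_of_le_ne_top (by finiteness) (hB x))

theorem IsBessel.tendsto_inner_cofinite (hf : IsBessel 𝕜 f) (x : H) :
    Tendsto (fun i => inner 𝕜 (f i) x) cofinite (𝓝 0) := by
  have h := ((hf.memℓp_inner x).summable (by norm_num)).tendsto_cofinite_zero
  rw [tendsto_zero_iff_norm_tendsto_zero]
  simpa using h.sqrt

/-- The analysis operator `x ↦ (⟨x, f_i⟩)_i` of a Bessel sequence, as a linear map into `ℓ²`. -/
noncomputable def IsBessel.analysisₗ (hf : IsBessel 𝕜 f) : H →ₗ[𝕜] lp (fun _ : ι => 𝕜) 2 where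
  toFun x := ⟨fun i => inner 𝕜 (f i) x, hf.memℓp_inner x⟩
  map_add' x y := by ext i; exact inner_add_right _ _ _
  map_smul' c x := by ext i; exact inner_smul_right _ _ _

theorem IsBessel.exists_norm_analysisₗ_le (hf : IsBessel 𝕜 f) :
    ∃ C : ℝ, ∀ x, ‖hf.analysisₗ x‖ ≤ C * ‖x‖ := by
  obtain ⟨B, hB⟩ := id hf
  refine ⟨NNReal.sqrt B, fun x => ?_⟩
  have h : ‖hf.analysisₗ x‖ₑ ^ 2 ≤ B * ‖x‖ₑ ^ 2 := (lp_enorm_sq _).trans_le (hB x)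
  simp only [enorm_eq_nnnorm] at h
  norm_cast at h
  rw [← NNReal.sq_sqrt B, ← mul_pow] at h
  exact NNReal.coe_le_coe.2 ((pow_le_pow_iff_left₀ zero_le zero_le two_ne_zero).1 h)

/-- The analysis operator of a Bessel sequence, as a bounded operator. -/
noncomputable def IsBessel.analysis (hf : IsBessel 𝕜 f) : H →L[𝕜] lp (fun _ : ι => 𝕜) 2 :=
  hf.analysisₗ.mkContinuousOfExistsBound hf.exists_norm_analysisₗ_le

@[simp]
theorem IsBessel.analysis_apply (hf : IsBessel 𝕜 f) (x : H) (i : ι) :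
    hf.analysis x i = inner 𝕜 (f i) x := rfl

theorem IsBessel.enorm_analysis_sq (hf : IsBessel 𝕜 f) (x : H) :
    ‖hf.analysis x‖ₑ ^ 2 = ∑' i, ‖inner 𝕜 (f i) x‖ₑ ^ 2 :=
  lp_enorm_sq _

theorem IsBessel.inner_analysis (hf : IsBessel 𝕜 f) (x y : H) :
    HasSum (fun i => inner 𝕜 x (f i) * inner 𝕜 (f i) y)
      (inner 𝕜 (hf.analysis x) (hf.analysis y)) := by
  convert lp.hasSum_inner (𝕜 := 𝕜) (G := fun _ : ι => 𝕜) (hf.analysis x) (hf.analysis y) using 2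
  rw [hf.analysis_apply, hf.analysis_apply, RCLike.inner_apply, inner_conj_symm, mul_comm]

theorem enorm_inner_self (x : H) : ‖inner 𝕜 x x‖ₑ = ‖x‖ₑ ^ 2 := by
  rw [inner_self_eq_norm_sq_to_K, enorm_pow, ← ofReal_norm, RCLike.norm_ofReal, abs_norm,
    ofReal_norm]

theorem IsBessel.exists_enorm_sq_le (hf : IsBessel 𝕜 f) : ∃ B : ℝ≥0, ∀ i, ‖f i‖ₑ ^ 2 ≤ B := by
  obtain ⟨B, hB⟩ := hf
  refine ⟨B, fun i => ?_⟩
  have norm_pow_four : ‖f i‖ₑ ^ 2 * ‖f i‖ₑ ^ 2 ≤ B * ‖f i‖ₑ ^ 2 := by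
    simpa only [enorm_inner_self, sq (‖f i‖ₑ ^ 2)] using (ENNReal.le_tsum i).trans (hB (f i))
  rcases eq_or_ne (f i) 0 with h | h
  · simp [h]
  · exact (ENNReal.mul_le_mul_iff_left (by simpa using h) (by finiteness)).1 norm_pow_four

theorem IsBessel.exists_tsum_inner_sq_le (hf : IsBessel 𝕜 f) (hg : IsBessel 𝕜 g) :
    ∃ P : ℝ≥0, ∀ k, ∑' i, ‖inner 𝕜 (f i) (g k)‖ₑ ^ 2 ≤ P := by
  obtain ⟨B, hB⟩ := hf
  obtain ⟨B', hB'⟩ := hg.exists_enorm_sq_le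
  refine ⟨B * B', fun k => (hB (g k)).trans ?_⟩
  rw [ENNReal.coe_mul]
  gcongr
  exact hB' k

variable [CompleteSpace H]

theorem IsBessel.map {K : Type*} [NormedAddCommGroup K] [InnerProductSpace 𝕜 K] [CompleteSpace K]
    (hf : IsBessel 𝕜 f) (T : H →L[𝕜] K) : IsBessel 𝕜 fun i => T (f i) := by
  obtain ⟨B, hB⟩ := hf
  refine ⟨B * ‖ContinuousLinearMap.adjoint T‖₊ ^ 2, fun x => ?_⟩
  simp_rw [← ContinuousLinearMap.adjoint_inner_right]
  refine (hB _).trans ?_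
  rw [ENNReal.coe_mul, mul_assoc, ENNReal.coe_pow, ← mul_pow]
  gcongr
  exact ContinuousLinearMap.le_opENorm _ _

theorem IsBessel.adjoint_analysis_analysis (hf : IsBessel 𝕜 f) (x : H) :
    ContinuousLinearMap.adjoint hf.analysis (hf.analysis x) = frameOp 𝕜 f x := by
  classical
  have h := (lp.hasSum_single (p := 2) (by norm_num) (hf.analysis x)).mapL
    (ContinuousLinearMap.adjoint hf.analysis)
  rw [← h.tsum_eq, frameOp]
  refine tsum_congr fun i => ext_inner_right 𝕜 fun y => ?_
  rw [ContinuousLinearMap.adjoint_inner_left, lp.inner_single_left, hf.analysis_apply,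
    hf.analysis_apply, inner_smul_left, RCLike.inner_apply, mul_comm]

theorem IsFrame.isUnit_adjoint_analysis_comp_analysis (hf : IsFrame 𝕜 f) :
    IsUnit (ContinuousLinearMap.adjoint hf.isBessel.analysis ∘L hf.isBessel.analysis) := by
  obtain ⟨A, B, hA, h⟩ := isFrame_iff.1 hf
  refine ContinuousLinearMap.isUnit_of_forall_le_norm_inner_map _ hA fun x => ?_
  have lower : ‖x‖ₑ ^ 2 * A ≤ ‖inner 𝕜 (hf.isBessel.analysis x) (hf.isBessel.analysis x)‖ₑ := by
    rw [enorm_inner_self, hf.isBessel.enorm_analysis_sq, mul_comm]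
    exact (h x).1
  rw [ContinuousLinearMap.comp_apply, ContinuousLinearMap.adjoint_inner_left]
  simp only [enorm_eq_nnnorm] at lower
  exact_mod_cast lower

/-- The frame operator of a frame, as an isomorphism of `H`. -/
noncomputable def IsFrame.frameEquiv (hf : IsFrame 𝕜 f) : H ≃L[𝕜] H :=
  ContinuousLinearEquiv.ofUnit hf.isUnit_adjoint_analysis_comp_analysis.unit

theorem IsFrame.frameEquiv_apply (hf : IsFrame 𝕜 f) (x : H) :
    hf.frameEquiv x = ContinuousLinearMap.adjoint hf.isBessel.analysis (hf.isBessel.analysis x) :=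
  rfl

theorem IsFrame.frameEquiv_eq_frameOp (hf : IsFrame 𝕜 f) : hf.frameEquiv = frameOp 𝕜 f :=
  funext hf.isBessel.adjoint_analysis_analysis

theorem IsFrame.inner_frameEquiv_left (hf : IsFrame 𝕜 f) (x y : H) :
    inner 𝕜 (hf.frameEquiv x) y = inner 𝕜 (hf.isBessel.analysis x) (hf.isBessel.analysis y) := by
  rw [hf.frameEquiv_apply, ContinuousLinearMap.adjoint_inner_left]

theorem IsFrame.inner_frameEquiv_right (hf : IsFrame 𝕜 f) (x y : H) :
    inner 𝕜 x (hf.frameEquiv y) = inner 𝕜 (hf.isBessel.analysis x) (hf.isBessel.analysis y) := by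
  rw [hf.frameEquiv_apply, ContinuousLinearMap.adjoint_inner_right]

theorem IsFrame.inner_frameEquiv_symm_left (hf : IsFrame 𝕜 f) (x y : H) :
    inner 𝕜 (hf.frameEquiv.symm x) y = inner 𝕜 x (hf.frameEquiv.symm y) := by
  conv_lhs => rw [← hf.frameEquiv.apply_symm_apply y]
  rw [hf.inner_frameEquiv_right, ← hf.inner_frameEquiv_left, hf.frameEquiv.apply_symm_apply]

theorem IsFrame.canonicalDual_eq (hf : IsFrame 𝕜 f) (i : ι) :
    canonicalDual 𝕜 f i = hf.frameEquiv.symm (f i) := by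
  rw [canonicalDual, ← hf.frameEquiv_eq_frameOp, ContinuousLinearEquiv.eq_symm_apply]
  exact Function.invFun_eq (hf.frameEquiv.surjective (f i))

theorem IsFrame.isBessel_canonicalDual (hf : IsFrame 𝕜 f) : IsBessel 𝕜 (canonicalDual 𝕜 f) := by
  rw [funext hf.canonicalDual_eq]
  exact hf.isBessel.map (hf.frameEquiv.symm : H →L[𝕜] H)

theorem IsFrame.inner_analysis_canonicalDual (hf : IsFrame 𝕜 f) (i : ι) (x : H) :
    inner 𝕜 (hf.isBessel.analysis (canonicalDual 𝕜 f i)) (hf.isBessel.analysis x) =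
      inner 𝕜 (f i) x := by
  rw [hf.canonicalDual_eq, ← hf.inner_frameEquiv_left, hf.frameEquiv.apply_symm_apply]

theorem IsFrame.inner_canonicalDual_left (hf : IsFrame 𝕜 f) (i k : ι) :
    inner 𝕜 (canonicalDual 𝕜 f i) (f k) = inner 𝕜 (f i) (canonicalDual 𝕜 f k) := by
  rw [hf.canonicalDual_eq, hf.canonicalDual_eq, hf.inner_frameEquiv_symm_left]

theorem IsFrame.hasSum_inner (hf : IsFrame 𝕜 f) (x y : H) :
    HasSum (fun k => inner 𝕜 x (canonicalDual 𝕜 f k) * inner 𝕜 (f k) y) (inner 𝕜 x y) := by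
  have h := hf.isBessel.inner_analysis (hf.frameEquiv.symm x) y
  rw [← hf.inner_frameEquiv_left, hf.frameEquiv.apply_symm_apply] at h
  simpa only [hf.canonicalDual_eq, ← hf.inner_frameEquiv_symm_left] using h

/-! ### The numbers `⟨f_i, f̃_i⟩` -/

theorem IsFrame.dualPairing_eq_enorm_sq (hf : IsFrame 𝕜 f) (i : ι) :
    dualPairing 𝕜 f i = ‖hf.isBessel.analysis (canonicalDual 𝕜 f i)‖ₑ ^ 2 := by
  rw [dualPairing, inner_re_symm, ← hf.inner_analysis_canonicalDual, inner_self_eq_norm_sq,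
    ENNReal.ofReal_pow (norm_nonneg _), ofReal_norm]

theorem IsFrame.dualPairing_le_one (hf : IsFrame 𝕜 f) (i : ι) : dualPairing 𝕜 f i ≤ 1 := by
  have enorm_inner : ‖inner 𝕜 (f i) (canonicalDual 𝕜 f i)‖ₑ = dualPairing 𝕜 f i := by
    rw [← hf.inner_analysis_canonicalDual, enorm_inner_self, hf.dualPairing_eq_enorm_sq]
  have sq_le : dualPairing 𝕜 f i * dualPairing 𝕜 f i ≤ 1 * dualPairing 𝕜 f i := by
    conv_rhs => rw [hf.dualPairing_eq_enorm_sq, hf.isBessel.enorm_analysis_sq]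
    rw [← enorm_inner, ← sq, one_mul]
    exact ENNReal.le_tsum (f := fun k => ‖inner 𝕜 (f k) (canonicalDual 𝕜 f i)‖ₑ ^ 2) i
  rcases eq_or_ne (dualPairing 𝕜 f i) 0 with h | h
  · simp [h]
  · exact (ENNReal.mul_le_mul_iff_left h ENNReal.ofReal_ne_top).1 sq_le

theorem IsRieszBasis.dualPairing_eq_one (hR : IsRieszBasis 𝕜 f) (hf : IsFrame 𝕜 f) (i : ι) :
    dualPairing 𝕜 f i = 1 := by
  classical
  obtain ⟨b, T, hT⟩ := hR
  set y : H := ContinuousLinearMap.adjoint (T.symm : H →L[𝕜] H) (b i) with hy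
  have biorthogonal (k : ι) : inner 𝕜 (f k) y = if k = i then 1 else 0 := by
    simp [hy, hT, ContinuousLinearMap.adjoint_inner_right, orthonormal_iff_ite.1 b.orthonormal]
  have frameOp_y : hf.frameEquiv y = f i := by
    simp [hf.frameEquiv_eq_frameOp, frameOp, biorthogonal, ite_smul, tsum_ite_eq]
  have dual_eq : canonicalDual 𝕜 f i = y := by
    rw [hf.canonicalDual_eq, ← frameOp_y, hf.frameEquiv.symm_apply_apply]
  rw [dualPairing, dual_eq, inner_re_symm, biorthogonal, if_pos rfl, RCLike.one_re,
    ENNReal.ofReal_one]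

end Frames

/-! ### Removing infinitely many frame elements -/

section Removal

variable {𝕜 : Type*} [RCLike 𝕜] {H : Type*} [NormedAddCommGroup H] [InnerProductSpace 𝕜 H]
  {ι : Type*} {φ : ι → H} {s : Finset ι} {K : ℝ}

theorem norm_sum_smul_sq_le_of_gram (hK : ∀ i ∈ s, ∑ k ∈ s, ‖inner 𝕜 (φ i) (φ k)‖ ≤ K)
    (c : ι → 𝕜) : ‖∑ i ∈ s, c i • φ i‖ ^ 2 ≤ K * ∑ i ∈ s, ‖c i‖ ^ 2 := by
  have swap : ∑ i ∈ s, ∑ k ∈ s, ‖c k‖ ^ 2 * ‖inner 𝕜 (φ i) (φ k)‖ =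
      ∑ i ∈ s, ∑ k ∈ s, ‖c i‖ ^ 2 * ‖inner 𝕜 (φ i) (φ k)‖ := by
    rw [Finset.sum_comm]
    simp_rw [norm_inner_symm]
  calc ‖∑ i ∈ s, c i • φ i‖ ^ 2
      = ‖∑ i ∈ s, ∑ k ∈ s, inner 𝕜 (c i • φ i) (c k • φ k)‖ := by
        rw [← inner_self_eq_norm_sq (𝕜 := 𝕜), inner_self_re_eq_norm]
        simp_rw [sum_inner, inner_sum]
    _ ≤ ∑ i ∈ s, ∑ k ∈ s, ‖inner 𝕜 (c i • φ i) (c k • φ k)‖ :=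
        (norm_sum_le _ _).trans (Finset.sum_le_sum fun i _ => norm_sum_le _ _)
    _ ≤ ∑ i ∈ s, ∑ k ∈ s, (‖c i‖ ^ 2 * ‖inner 𝕜 (φ i) (φ k)‖ +
          ‖c k‖ ^ 2 * ‖inner 𝕜 (φ i) (φ k)‖) / 2 := by
        gcongr with i _ k _
        rw [inner_smul_left, inner_smul_right, norm_mul, norm_mul, RCLike.norm_conj]
        nlinarith [two_mul_le_add_sq ‖c i‖ ‖c k‖, norm_nonneg (inner 𝕜 (φ i) (φ k))]
    _ = ∑ i ∈ s, ‖c i‖ ^ 2 * ∑ k ∈ s, ‖inner 𝕜 (φ i) (φ k)‖ := by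
        simp_rw [← Finset.sum_div, Finset.sum_add_distrib, swap, Finset.mul_sum, add_self_div_two]
    _ ≤ K * ∑ i ∈ s, ‖c i‖ ^ 2 := by
        rw [mul_comm, Finset.sum_mul]
        gcongr with i hi
        exact hK i hi

theorem sum_norm_inner_sq_le_of_gram (hK₀ : 0 ≤ K)
    (hK : ∀ i ∈ s, ∑ k ∈ s, ‖inner 𝕜 (φ i) (φ k)‖ ≤ K) (y : H) :
    ∑ i ∈ s, ‖inner 𝕜 (φ i) y‖ ^ 2 ≤ K * ‖y‖ ^ 2 := by
  set Q : ℝ := ∑ i ∈ s, ‖inner 𝕜 (φ i) y‖ ^ 2 with hQ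
  set v : H := ∑ i ∈ s, (inner 𝕜 (φ i) y : 𝕜) • φ i with hv
  have inner_v : inner 𝕜 v y = (Q : 𝕜) := by
    simp_rw [hv, hQ, sum_inner, inner_smul_left, RCLike.conj_mul, RCLike.ofReal_sum,
      RCLike.ofReal_pow]
  have Q_nonneg : 0 ≤ Q := by positivity
  have Q_le : Q ≤ ‖v‖ * ‖y‖ := by
    simpa [inner_v, abs_of_nonneg Q_nonneg] using norm_inner_le_norm (𝕜 := 𝕜) v y
  have Q_sq_le : Q * Q ≤ K * ‖y‖ ^ 2 * Q := by
    calc Q * Q ≤ (‖v‖ * ‖y‖) * (‖v‖ * ‖y‖) := by gcongr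
      _ = ‖v‖ ^ 2 * ‖y‖ ^ 2 := by ring
      _ ≤ K * Q * ‖y‖ ^ 2 := by gcongr; exact norm_sum_smul_sq_le_of_gram hK _
      _ = K * ‖y‖ ^ 2 * Q := by ring
  rcases Q_nonneg.eq_or_lt with h | h
  · rw [← h]; positivity
  · exact le_of_mul_le_mul_right Q_sq_le h

theorem exists_injective_forall_lt {M : ι → ι → ℝ} (hM : ∀ i, Tendsto (M i) cofinite (𝓝 0))
    {t : Set ι} (ht : t.Infinite) {δ : ℕ → ℝ} (hδ : ∀ m, 0 < δ m) :
    ∃ u : ℕ → ι, u.Injective ∧ (∀ m, u m ∈ t) ∧ ∀ m m', m < m' → M (u m) (u m') < δ m' := by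
  classical
  have next (T : Finset ι) (m : ℕ) : ∃ y ∈ t, y ∉ T ∧ ∀ x ∈ T, M x y < δ m := by
    have small : ∀ᶠ y in cofinite, ∀ x ∈ T, M x y < δ m :=
      (eventually_all_finset T).2 fun x _ => (hM x).eventually_lt_const (hδ m)
    have fresh : ∀ᶠ y in cofinite, y ∉ T := T.finite_toSet.eventually_cofinite_notMem
    exact (ht.frequently_cofinite.and_eventually (fresh.and small)).exists
  choose y y_mem y_fresh y_small using next
  let T : ℕ → Finset ι := fun m => m.rec ∅ fun k T => insert (y T k) T
  have T_mono : Monotone T := monotone_nat_of_le_succ fun m => Finset.subset_insert _ _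
  have mem_T {m m' : ℕ} (h : m < m') : y (T m) m ∈ T m' :=
    T_mono h (Finset.mem_insert_self _ _)
  refine ⟨fun m => y (T m) m, .of_lt_imp_ne fun m m' h heq => ?_,
    fun m => y_mem _ _, fun m m' h => y_small _ _ _ (mem_T h)⟩
  exact y_fresh (T m') m' (heq ▸ mem_T h)

theorem exists_infinite_tsum_inner_sq_le
    (hφ : ∀ i, Tendsto (fun k => inner 𝕜 (φ k) (φ i)) cofinite (𝓝 0)) {L θ : ℝ≥0} (hLθ : L < θ)
    (hinf : {i | ‖φ i‖ₑ ^ 2 ≤ L}.Infinite) :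
    ∃ J : Set ι, J.Infinite ∧ ∀ y, ∑' i : J, ‖inner 𝕜 (φ i) y‖ₑ ^ 2 ≤ θ * ‖y‖ₑ ^ 2 := by
  have gap_pos : (0 : ℝ) < θ - L := sub_pos.2 hLθ
  obtain ⟨u, u_inj, hu, off_diag⟩ := exists_injective_forall_lt
    (M := fun i k => ‖inner 𝕜 (φ k) (φ i)‖) (fun i => by simpa using (hφ i).norm) hinf
    (δ := fun m => (θ - L) / 2 / 2 ^ m) fun m => by positivity
  have diag (m : ℕ) : ‖inner 𝕜 (φ (u m)) (φ (u m))‖ ≤ L := by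
    have h : ‖φ (u m)‖ₑ ^ 2 ≤ L := hu m
    rw [← enorm_inner_self (𝕜 := 𝕜), enorm_eq_nnnorm] at h
    exact_mod_cast h
  have gram_le (m k : ℕ) : ‖inner 𝕜 (φ (u m)) (φ (u k))‖ ≤
      (if k = m then (L : ℝ) else 0) + (θ - L) / 2 / 2 ^ k := by
    rcases lt_trichotomy k m with h | rfl | h
    · rw [if_neg h.ne, zero_add]
      refine (off_diag k m h).le.trans ?_
      gcongr
      exact one_le_two
    · rw [if_pos rfl]
      exact (diag k).trans (le_add_of_nonneg_right (by positivity))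
    · rw [if_neg h.ne', zero_add, norm_inner_symm]
      exact (off_diag m k h).le
  have row_le (s : Finset ℕ) (m : ℕ) (hm : m ∈ s) :
      ∑ k ∈ s, ‖inner 𝕜 (φ (u m)) (φ (u k))‖ ≤ θ := by
    have geometric : ∑ k ∈ s, ((θ : ℝ) - L) / 2 / 2 ^ k ≤ θ - L :=
      sum_le_hasSum s (fun _ _ => by positivity) (hasSum_geometric_two' _)
    have h := Finset.sum_le_sum fun k (_ : k ∈ s) => gram_le m k
    rw [Finset.sum_add_distrib, Finset.sum_ite_eq', if_pos hm] at h
    linarith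
  refine ⟨Set.range u, Set.infinite_range_of_injective u_inj, fun y => ?_⟩
  rw [tsum_range (fun i => ‖inner 𝕜 (φ i) y‖ₑ ^ 2) u_inj]
  refine ENNReal.summable.tsum_le_of_sum_le fun s => ?_
  simp only [enorm_eq_nnnorm]
  norm_cast
  exact NNReal.coe_le_coe.1 (by
    push_cast; exact sum_norm_inner_sq_le_of_gram θ.coe_nonneg (row_le s) y)

theorem IsFrame.compl {f : ι → H} (hf : IsFrame 𝕜 f) {J : Set ι} {θ : ℝ≥0} (hθ : θ < 1)
    (hJ : ∀ x, ∑' i : J, ‖inner 𝕜 (f i) x‖ₑ ^ 2 ≤ θ * ∑' i, ‖inner 𝕜 (f i) x‖ₑ ^ 2) :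
    IsFrame 𝕜 fun i : ↥Jᶜ => f i := by
  obtain ⟨A, B, hA, h⟩ := isFrame_iff.1 hf
  refine isFrame_iff.2 ⟨(1 - θ) * A, B, mul_pos (tsub_pos_of_lt hθ) hA, fun x => ⟨?_, ?_⟩⟩
  · set total := ∑' i, ‖inner 𝕜 (f i) x‖ₑ ^ 2
    have total_ne_top : total ≠ ∞ := ne_top_of_le_ne_top (by finiteness) (h x).2
    have split : ∑' i : J, ‖inner 𝕜 (f i) x‖ₑ ^ 2 + ∑' i : ↥Jᶜ, ‖inner 𝕜 (f i) x‖ₑ ^ 2 = total :=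
      ENNReal.summable.tsum_add_tsum_compl (f := fun i => ‖inner 𝕜 (f i) x‖ₑ ^ 2) ENNReal.summable
    calc ((1 - θ) * A : ℝ≥0) * ‖x‖ₑ ^ 2 = (1 - θ) * (A * ‖x‖ₑ ^ 2) := by
          rw [ENNReal.coe_mul, ENNReal.coe_sub, ENNReal.coe_one, mul_assoc]
      _ ≤ (1 - θ) * total := by gcongr; exact (h x).1
      _ = total - θ * total := by rw [ENNReal.sub_mul fun _ _ => total_ne_top, one_mul]
      _ ≤ ∑' i : ↥Jᶜ, ‖inner 𝕜 (f i) x‖ₑ ^ 2 := by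
          rw [tsub_le_iff_left, ← split]
          gcongr
          exact (hJ x).trans_eq (by rw [split])
  · exact (ENNReal.tsum_comp_le_tsum_of_injective Subtype.val_injective _).trans (h x).2

variable [CompleteSpace H]

-- In the range of the analysis operator `C`, the frame is represented by the vectors `C f̃_i`,
-- because `⟨C f̃_i, C x⟩ = ⟨f_i, x⟩`; their squared norms are the numbers `⟨f_i, f̃_i⟩`, and each
-- row of their Gram matrix is square-summable.
theorem IsFrame.exists_infinite_isFrame_compl {f : ι → H} (hf : IsFrame 𝕜 f) {L : ℝ≥0∞}
    (hL : L < 1) (hinf : {i | dualPairing 𝕜 f i < L}.Infinite) :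
    ∃ J : Set ι, J.Infinite ∧ IsFrame 𝕜 fun i : ↥Jᶜ => f i := by
  obtain ⟨θ₀, hLθ₀, hθ₀⟩ := ENNReal.lt_iff_exists_nnreal_btwn.1 hL
  obtain ⟨θ, hθ₀θ, hθ⟩ := exists_between (ENNReal.coe_lt_one_iff.1 hθ₀)
  set φ := fun i => hf.isBessel.analysis (canonicalDual 𝕜 f i) with hφ
  have gram_tendsto (i : ι) : Tendsto (fun k => inner 𝕜 (φ k) (φ i)) cofinite (𝓝 0) := by
    simp only [hφ, hf.inner_analysis_canonicalDual]
    exact hf.isBessel.tendsto_inner_cofinite _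
  have infinite_norm_le : {i | ‖φ i‖ₑ ^ 2 ≤ θ₀}.Infinite := by
    refine hinf.mono fun i (hi : dualPairing 𝕜 f i < L) => ?_
    rw [hf.dualPairing_eq_enorm_sq] at hi
    exact hi.le.trans hLθ₀.le
  obtain ⟨J, hJ, sum_le⟩ := exists_infinite_tsum_inner_sq_le gram_tendsto hθ₀θ infinite_norm_le
  refine ⟨J, hJ, hf.compl hθ fun x => ?_⟩
  simpa only [hφ, hf.inner_analysis_canonicalDual, hf.isBessel.enorm_analysis_sq] using
    sum_le (hf.isBessel.analysis x)

end Removal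

/-! ### Boxes in the reference group -/

section Boxes

variable {d e : ℕ} {n : Fin e → ℕ} {α : Fin d → ℝ}

theorem size_le_iff {g : RefGroup d n} {r : ℝ} (hr : 0 ≤ r) :
    size α g ≤ r ↔ (∀ i, |α i * g.1 i| ≤ r) ∧ ∀ l, g.2 l ≠ 0 → 1 ≤ r := by
  have iSup_le_iff {m : ℕ} (v : Fin m → ℝ) : ⨆ i, v i ≤ r ↔ ∀ i, v i ≤ r :=
    ⟨fun h i => (le_ciSup (Set.finite_range v).bddAbove i).trans h, fun h => Real.iSup_le h hr⟩
  rw [size, max_le_iff, iSup_le_iff, iSup_le_iff]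
  refine and_congr_right fun _ => forall_congr' fun l => ?_
  split_ifs with h <;> simp [h, hr]

theorem size_nonneg (g : RefGroup d n) : 0 ≤ size α g :=
  le_max_of_le_left (Real.iSup_nonneg fun _ => abs_nonneg _)

theorem size_add_le (g h : RefGroup d n) : size α (g + h) ≤ size α g + size α h := by
  have hg := (size_le_iff (α := α) (size_nonneg g)).1 le_rfl
  have hh := (size_le_iff (α := α) (size_nonneg h)).1 le_rfl
  have hg₀ := size_nonneg (α := α) g
  have hh₀ := size_nonneg (α := α) h
  refine (size_le_iff (by positivity)).2 ⟨fun i => ?_, fun l hl => ?_⟩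
  · rw [Prod.fst_add, Pi.add_apply, Int.cast_add, mul_add]
    exact (abs_add_le _ _).trans (add_le_add (hg.1 i) (hh.1 i))
  · by_cases hgl : g.2 l = 0
    · have hhl : h.2 l ≠ 0 := by simpa [hgl] using hl
      linarith [hh.2 l hhl]
    · linarith [hg.2 l hgl]

theorem self_mem_box (N : ℕ) (j : RefGroup d n) : j ∈ box α N j := by
  have hN : (0 : ℝ) ≤ N / 2 := by positivity
  simp [box, size_le_iff hN, hN]

theorem mem_box_trans {N M : ℕ} {j k m : RefGroup d n} (hk : k ∈ box α N j)
    (hm : m ∈ box α M k) : m ∈ box α (N + M) j := by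
  have h := size_add_le (α := α) (m - k) (k - j)
  rw [sub_add_sub_cancel] at h
  have hk' : size α (k - j) ≤ N / 2 := hk
  have hm' : size α (m - k) ≤ M / 2 := hm
  change size α (m - j) ≤ (N + M : ℕ) / 2
  push_cast
  linarith

theorem box_mono {N M : ℕ} (h : N ≤ M) (j : RefGroup d n) : box α N j ⊆ box α M j := fun k hk =>
  le_trans (show size α (k - j) ≤ N / 2 from hk) (by gcongr)

theorem box_eq_image_add (N : ℕ) (j : RefGroup d n) : box α N j = (· + j) '' box α N 0 := by
  ext k
  rw [Set.image_add_right]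
  simp [box, sub_eq_add_neg]

/-- The common cardinality of the boxes `S_N(j)`. -/
noncomputable def boxCard {d e : ℕ} (α : Fin d → ℝ) (n : Fin e → ℕ) (N : ℕ) : ℕ :=
  (box α N (0 : RefGroup d n)).ncard

variable [∀ l, NeZero (n l)]

theorem box_zero_eq (hα : ∀ i, 0 < α i) {N : ℕ} (hN : 2 ≤ N) :
    box α N (0 : RefGroup d n) =
      ↑(Finset.Icc (fun i => -(⌊(2 * α i)⁻¹ * N⌋₊ : ℤ)) (fun i => (⌊(2 * α i)⁻¹ * N⌋₊ : ℤ)) ×ˢ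
        (Finset.univ : Finset ((l : Fin e) → ZMod (n l)))) := by
  ext k
  have one_le : (1 : ℝ) ≤ N / 2 := by
    rw [le_div_iff₀ two_pos]
    exact_mod_cast hN
  have coordinate (i : Fin d) : |α i * k.1 i| ≤ N / 2 ↔
      -(⌊(2 * α i)⁻¹ * N⌋₊ : ℤ) ≤ k.1 i ∧ k.1 i ≤ ⌊(2 * α i)⁻¹ * N⌋₊ := by
    have := hα i
    rw [← abs_le, Int.abs_eq_natAbs, Nat.cast_le, Nat.le_floor_iff (by positivity), Nat.cast_natAbs,
      Int.cast_abs, abs_mul, abs_of_pos this, ← div_eq_inv_mul, le_div_iff₀ (by positivity),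
      le_div_iff₀ (by positivity)]
    ring_nf
  simp only [box, sub_zero, Set.mem_ofPred_eq, size_le_iff (zero_le_one.trans one_le), one_le,
    implies_true, and_true, coordinate, forall_and, Finset.coe_product, Finset.coe_Icc,
    Finset.coe_univ, Set.mem_prod, Set.mem_Icc, Set.mem_univ, Pi.le_def]

theorem box_finite (hα : ∀ i, 0 < α i) (N : ℕ) (j : RefGroup d n) : (box α N j).Finite := by
  have h : (box α (N + 2) (0 : RefGroup d n)).Finite := by
    rw [box_zero_eq hα (Nat.le_add_left 2 N)]
    exact Finset.finite_toSet _
  rw [box_eq_image_add]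
  exact (h.subset (box_mono (Nat.le_add_right N 2) 0)).image _

theorem encard_box (hα : ∀ i, 0 < α i) (N : ℕ) (j : RefGroup d n) :
    (box α N j).encard = boxCard α n N := by
  rw [box_eq_image_add, (add_left_injective j).encard_image, boxCard,
    (box_finite hα N 0).cast_ncard_eq]

theorem boxCard_pos (hα : ∀ i, 0 < α i) (N : ℕ) : 0 < boxCard α n N :=
  (Set.ncard_pos (box_finite hα N 0)).2 ⟨0, self_mem_box N 0⟩

theorem boxCard_eq (hα : ∀ i, 0 < α i) {N : ℕ} (hN : 2 ≤ N) :
    boxCard α n N = (∏ i, (2 * ⌊(2 * α i)⁻¹ * N⌋₊ + 1)) * ∏ l, n l := by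
  have card_Icc (m : ℕ) : (Finset.Icc (-m : ℤ) m).card = 2 * m + 1 := by
    rw [Int.card_Icc]
    lia
  rw [boxCard, box_zero_eq hα hN, Set.ncard_coe_finset, Finset.card_product, Pi.card_Icc,
    Finset.card_univ, Fintype.card_pi]
  simp_rw [card_Icc, ZMod.card]

theorem boxCard_isEquivalent (hα : ∀ i, 0 < α i) :
    (fun N => (boxCard α n N : ℝ)) ~[atTop]
      fun N => (∏ i, (α i)⁻¹) * (∏ l, (n l : ℝ)) * (N : ℝ) ^ d := by
  have side (i : Fin d) :
      (fun N : ℕ => (2 * ⌊(2 * α i)⁻¹ * N⌋₊ + 1 : ℝ)) ~[atTop] fun N => (α i)⁻¹ * N := by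
    have := hα i
    have tendsto_mul {c : ℝ} (hc : 0 < c) : Tendsto (fun N : ℕ => c * (N : ℝ)) atTop atTop :=
      tendsto_natCast_atTop_atTop.const_mul_atTop hc
    have floor : (fun N : ℕ => (⌊(2 * α i)⁻¹ * N⌋₊ : ℝ)) ~[atTop] fun N => (2 * α i)⁻¹ * N :=
      isEquivalent_nat_floor.comp_tendsto (tendsto_mul (by positivity))
    have two_mul_floor := (IsEquivalent.refl (u := fun _ : ℕ => (2 : ℝ))).mul floor
    have linear : (fun _ => (2 : ℝ)) * (fun N : ℕ => (2 * α i)⁻¹ * (N : ℝ)) =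
        fun N : ℕ => (α i)⁻¹ * (N : ℝ) := by
      ext N
      simp only [Pi.mul_apply]
      field_simp
    rw [linear] at two_mul_floor
    refine two_mul_floor.add_isLittleO (isLittleO_const_left.2 (.inr ?_))
    exact tendsto_norm_atTop_atTop.comp (tendsto_mul (by positivity))
  refine (((IsEquivalent.finsetProd (s := Finset.univ) fun i _ => side i).mul
    (IsEquivalent.refl (u := fun _ => ∏ l, (n l : ℝ)))).congr_left ?_).congr_right ?_
  · filter_upwards [eventually_ge_atTop 2] with N hN
    simp [boxCard_eq hα hN]
  · refine .of_forall fun N => ?_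
    simp only [Pi.mul_apply, Finset.prod_mul_distrib, Finset.prod_const, Finset.card_univ,
      Fintype.card_fin]
    ring

theorem boxCard_sub_isEquivalent (hα : ∀ i, 0 < α i) (M : ℕ) :
    (fun N => (boxCard α n (N - M) : ℝ)) ~[atTop] fun N => (boxCard α n N : ℝ) := by
  have sub_isEquivalent : (fun N : ℕ => ((N - M : ℕ) : ℝ)) ~[atTop] fun N => (N : ℝ) := by
    refine IsLittleO.congr' (f₁ := fun _ => -(M : ℝ)) (g₁ := fun N : ℕ => (N : ℝ))
      (isLittleO_const_left.2 (.inr (tendsto_norm_atTop_atTop.comp tendsto_natCast_atTop_atTop)))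
      ?_ .rfl
    filter_upwards [eventually_ge_atTop M] with N hN
    simp [Nat.cast_sub hN]
  exact (((boxCard_isEquivalent hα).comp_tendsto (tendsto_sub_atTop_nat M)).trans
    (IsEquivalent.refl.mul (sub_isEquivalent.pow d))).trans (boxCard_isEquivalent hα).symm

theorem tendsto_boxCard_atTop (hd : 0 < d) (hα : ∀ i, 0 < α i) :
    Tendsto (boxCard α n) atTop atTop := by
  rw [← tendsto_natCast_atTop_iff (R := ℝ)]
  refine (boxCard_isEquivalent hα).symm.tendsto_atTop ?_
  have constant_pos : 0 < (∏ i, (α i)⁻¹) * ∏ l, (n l : ℝ) :=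
    mul_pos (Finset.prod_pos fun i _ => inv_pos.2 (hα i))
      (Finset.prod_pos fun l _ => Nat.cast_pos.2 (NeZero.pos _))
  exact ((tendsto_pow_atTop hd.ne').comp tendsto_natCast_atTop_atTop).const_mul_atTop constant_pos

theorem eventually_encard_box_diff_le (hα : ∀ i, 0 < α i) (M : ℕ) {η : ℝ≥0} (hη : 0 < η) :
    ∀ᶠ N in atTop, ∀ j : RefGroup d n,
      ((box α N j \ box α (N - M) j).encard : ℝ≥0∞) ≤ η * boxCard α n N := by
  filter_upwards [(boxCard_sub_isEquivalent (n := n) hα M).isLittleO.bound hη] with N hN j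
  have split := Set.encard_sdiff_add_encard_of_subset (box_mono (α := α) (Nat.sub_le N M) j)
  rw [encard_box hα, encard_box hα] at split
  obtain ⟨D, hD⟩ := ENat.ne_top_iff_exists.1 (box_finite hα N j).sdiff.encard_lt_top.ne
  rw [← hD] at split ⊢
  norm_cast at split
  have hD_le : (D : ℝ≥0) ≤ η * boxCard α n N := by
    rw [← NNReal.coe_le_coe]
    simpa [← split, abs_of_nonneg, add_nonneg] using hN
  rwa [← ENNReal.coe_le_coe, ENNReal.coe_mul, ENNReal.coe_natCast, ENNReal.coe_natCast] at hD_le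

end Boxes

/-! ### Localized weights -/

section Fibres

variable {ι : Type*}

theorem encard_preimage_le {G : Type*} {a : ι → G} {K : ℕ} (hK : ∀ g, (a ⁻¹' {g}).encard ≤ K)
    {Q : Set G} (hQ : Q.Finite) : (a ⁻¹' Q).encard ≤ K * Q.encard := by
  induction Q, hQ using Set.Finite.induction_on with
  | empty => simp
  | @insert g Q hg _ ih =>
    rw [Set.insert_eq, Set.preimage_union, ← Set.insert_eq, Set.encard_insert_of_notMem hg,
      mul_add, mul_one, add_comm]
    exact (Set.encard_union_le _ _).trans (add_le_add (hK g) ih)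

variable {d e : ℕ} {n : Fin e → ℕ} {α : Fin d → ℝ} [∀ l, NeZero (n l)] {a : ι → RefGroup d n}

theorem preBox_finite (hα : ∀ i, 0 < α i) {K : ℕ} (hK : ∀ g, (a ⁻¹' {g}).encard ≤ K) (N : ℕ)
    (j : RefGroup d n) : (preBox α a N j).Finite :=
  (box_finite hα N j).preimage' fun g _ => Set.finite_of_encard_le_coe (hK g)

theorem exists_encard_fiber_le (hα : ∀ i, 0 < α i) (hD : upperDensity α a < ∞) :
    ∃ K : ℕ, ∀ g, (a ⁻¹' {g}).encard ≤ K := by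
  obtain ⟨B, hB, hB_top⟩ := exists_between hD
  obtain ⟨N, hN⟩ := (eventually_lt_of_limsup_lt hB).exists
  obtain ⟨K, hK⟩ := ENNReal.exists_nat_gt
    (ENNReal.mul_ne_top hB_top.ne (ENNReal.natCast_ne_top (boxCard α n N)))
  refine ⟨K, fun g => ?_⟩
  have density_le : boxDensity α a N g ≤ B := (le_iSup _ g).trans hN.le
  have boxCard_ne_zero : (boxCard α n N : ℝ≥0∞) ≠ 0 := Nat.cast_ne_zero.2 (boxCard_pos hα N).ne'
  rw [boxDensity, encard_box hα, ENat.toENNReal_coe,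
    ENNReal.div_le_iff boxCard_ne_zero (ENNReal.natCast_ne_top _)] at density_le
  have fiber_subset : a ⁻¹' {g} ⊆ preBox α a N g := by
    rintro i rfl
    exact self_mem_box N _
  refine (Set.encard_le_encard fiber_subset).trans ?_
  exact_mod_cast density_le.trans hK.le

end Fibres

section Localization

theorem tsum_mul_le_of_tsum_sq_le {κ : Type*} {x y : κ → ℝ≥0∞} {P Q : ℝ≥0∞}
    (hx : ∑' k, x k ^ 2 ≤ P ^ 2) (hy : ∑' k, y k ^ 2 ≤ Q ^ 2) : ∑' k, x k * y k ≤ P * Q := by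
  have sqrt_sum_le {z : κ → ℝ≥0∞} {R : ℝ≥0∞} (hz : ∑' k, z k ^ 2 ≤ R ^ 2) (s : Finset κ) :
      (∑ k ∈ s, z k ^ (2 : ℝ)) ^ (1 / 2 : ℝ) ≤ R := by
    rw [one_div, ENNReal.rpow_inv_le_iff two_pos]
    simp_rw [ENNReal.rpow_two]
    exact (ENNReal.sum_le_tsum s).trans hz
  refine ENNReal.summable.tsum_le_of_sum_le fun s => ?_
  exact (ENNReal.inner_le_Lp_mul_Lq s x y .two_two).trans
    (mul_le_mul' (sqrt_sum_le hx s) (sqrt_sum_le hy s))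

variable {ι κ : Type*} {d e : ℕ} {n : Fin e → ℕ} {α : Fin d → ℝ} {a : ι → RefGroup d n}
  {b : κ → RefGroup d n} {u v w : ι → κ → ℝ≥0∞}

/-- The weights `w i k` are localized along `a` and `b`: their row sums are uniformly bounded and,
uniformly in `i`, concentrated on those `k` for which `b k` is close to `a i`. -/
structure IsLocalized (α : Fin d → ℝ) (a : ι → RefGroup d n) (b : κ → RefGroup d n)
    (w : ι → κ → ℝ≥0∞) : Prop where
  exists_tsum_le : ∃ C : ℝ≥0, ∀ i, ∑' k, w i k ≤ C
  exists_tsum_compl_le : ∀ δ : ℝ≥0, 0 < δ →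
    ∃ M, ∀ i, ∑' k : ↥(preBox α b M (a i))ᶜ, w i k ≤ δ

theorem IsLocalized.mul (hu : IsLocalized α a b fun i k => u i k ^ 2) {P : ℝ≥0}
    (hv : ∀ i, ∑' k, v i k ^ 2 ≤ P) : IsLocalized α a b fun i k => u i k * v i k := by
  set R := NNReal.sqrt P
  have hR : (P : ℝ≥0∞) = (R : ℝ≥0∞) ^ 2 := by
    rw [← ENNReal.coe_pow, NNReal.sq_sqrt]
  rw [hR] at hv
  constructor
  · obtain ⟨C, hC⟩ := hu.exists_tsum_le
    refine ⟨NNReal.sqrt C * R, fun i => ?_⟩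
    rw [ENNReal.coe_mul]
    refine tsum_mul_le_of_tsum_sq_le ((hC i).trans_eq ?_) (hv i)
    rw [← ENNReal.coe_pow, NNReal.sq_sqrt]
  · intro δ hδ
    obtain ⟨M, hM⟩ := hu.exists_tsum_compl_le ((δ / (R + 1)) ^ 2) (by positivity)
    refine ⟨M, fun i => ?_⟩
    calc ∑' k : ↥(preBox α b M (a i))ᶜ, u i k * v i k
        ≤ (δ / (R + 1) : ℝ≥0) * R := tsum_mul_le_of_tsum_sq_le (by exact_mod_cast hM i)
          ((ENNReal.tsum_comp_le_tsum_of_injective Subtype.val_injective _).trans (hv i))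
      _ ≤ δ := by
        norm_cast
        rw [div_mul_eq_mul_div, div_le_iff₀ (by positivity)]
        gcongr
        exact le_self_add

/-- The total weight leaving the box `S_N(j)`: the sum of `w i k` over the rows `i` above the box
and the columns `k` not above it. -/
noncomputable def leakage (α : Fin d → ℝ) (a : ι → RefGroup d n) (b : κ → RefGroup d n)
    (w : ι → κ → ℝ≥0∞) (N : ℕ) (j : RefGroup d n) : ℝ≥0∞ :=
  ∑' i : preBox α a N j, ∑' k : ↥(preBox α b N j)ᶜ, w i k

theorem tsum_subtype_le_encard_mul {s : Set ι} {x : ι → ℝ≥0∞} {c : ℝ≥0∞} (h : ∀ i ∈ s, x i ≤ c) :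
    ∑' i : s, x i ≤ s.encard * c :=
  (ENNReal.tsum_le_tsum fun i : s => h i i.2).trans_eq (ENNReal.tsum_set_const s c)

-- Only the rows in the boundary layer `S_N(j) \ S_{N-M}(j)` leak a substantial part of their sum.
theorem leakage_le {M : ℕ} {C δ : ℝ≥0∞} (hC : ∀ i, ∑' k, w i k ≤ C)
    (hδ : ∀ i, ∑' k : ↥(preBox α b M (a i))ᶜ, w i k ≤ δ) {N : ℕ} (hN : M ≤ N)
    (j : RefGroup d n) :
    leakage α a b w N j ≤ (preBox α a N j).encard * δ +
      (a ⁻¹' (box α N j \ box α (N - M) j)).encard * C := by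
  set row : ι → ℝ≥0∞ := fun i => ∑' k : ↥(preBox α b N j)ᶜ, w i k
  have cover : preBox α a N j = preBox α a (N - M) j ∪ a ⁻¹' (box α N j \ box α (N - M) j) := by
    rw [preBox, preBox, ← Set.preimage_union, Set.union_sdiff_cancel (box_mono (Nat.sub_le N M) j)]
  have inner_row_le (i : ι) (hi : i ∈ preBox α a (N - M) j) : row i ≤ δ := by
    refine (ENNReal.tsum_mono_subtype (w i) (Set.compl_subset_compl.2 fun k hk => ?_)).trans (hδ i)
    simpa [preBox, Nat.sub_add_cancel hN] using mem_box_trans hi hk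
  have row_le (i : ι) : row i ≤ C :=
    (ENNReal.tsum_comp_le_tsum_of_injective Subtype.val_injective _).trans (hC i)
  calc leakage α a b w N j
      ≤ ∑' i : preBox α a (N - M) j, row i +
          ∑' i : ↥(a ⁻¹' (box α N j \ box α (N - M) j)), row i := by
        rw [leakage, cover]
        exact ENNReal.tsum_union_le row _ _
    _ ≤ (preBox α a (N - M) j).encard * δ +
          (a ⁻¹' (box α N j \ box α (N - M) j)).encard * C :=
        add_le_add (tsum_subtype_le_encard_mul inner_row_le)
          (tsum_subtype_le_encard_mul fun i _ => row_le i)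
    _ ≤ _ := by
        gcongr
        exact Set.preimage_mono (box_mono (Nat.sub_le N M) j)

theorem IsLocalized.eventually_leakage_le [∀ l, NeZero (n l)] (hα : ∀ i, 0 < α i) {K : ℕ}
    (hK : ∀ g, (a ⁻¹' {g}).encard ≤ K) (hw : IsLocalized α a b w) {ε : ℝ≥0} (hε : 0 < ε) :
    ∀ᶠ N in atTop, ∀ j, leakage α a b w N j ≤ ε * boxCard α n N := by
  obtain ⟨C, hC⟩ := hw.exists_tsum_le
  obtain ⟨M, hM⟩ := hw.exists_tsum_compl_le (ε / 2 / (K + 1)) (by positivity)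
  filter_upwards [eventually_ge_atTop M, eventually_encard_box_diff_le (n := n) hα M
    (η := ε / 2 / (K * C + 1)) (by positivity)] with N hN layer_le j
  have encard_le {Q : Set (RefGroup d n)} (hQ : Q.Finite) :
      ((a ⁻¹' Q).encard : ℝ≥0∞) ≤ K * Q.encard := by
    exact_mod_cast ENat.toENNReal_mono (encard_preimage_le hK hQ)
  have box_encard_le := encard_le (box_finite hα N j)
  have layer_encard_le := encard_le (box_finite hα N j |>.sdiff (t := box α (N - M) j))
  rw [encard_box hα, ENat.toENNReal_coe] at box_encard_le
  have half {x : ℝ≥0} : x * (ε / 2 / (x + 1)) ≤ ε / 2 := by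
    rw [mul_div_assoc', div_le_iff₀ (by positivity), mul_comm]
    gcongr
    exact le_self_add
  calc leakage α a b w N j
      ≤ (preBox α a N j).encard * (ε / 2 / (K + 1) : ℝ≥0) +
          (a ⁻¹' (box α N j \ box α (N - M) j)).encard * C := leakage_le hC hM hN j
    _ ≤ K * boxCard α n N * (ε / 2 / (K + 1) : ℝ≥0) +
          K * ((ε / 2 / (K * C + 1) : ℝ≥0) * boxCard α n N) * C := by
        gcongr
        · exact box_encard_le
        · exact layer_encard_le.trans (mul_le_mul_right (layer_le j) _)
    _ = (K * (ε / 2 / (K + 1)) + K * C * (ε / 2 / (K * C + 1)) : ℝ≥0) * boxCard α n N := by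
        push_cast
        ring
    _ ≤ ε * boxCard α n N := by
        gcongr
        exact (add_le_add half half).trans_eq (add_halves ε)

end Localization

/-! ### Comparison of two frames -/

section Comparison

variable {𝕜 : Type*} [RCLike 𝕜] {H : Type*} [NormedAddCommGroup H] [InnerProductSpace 𝕜 H]
  {ι κ : Type*} {f : ι → H} {g : κ → H}

theorem enorm_inner_symm (x y : H) : ‖inner 𝕜 x y‖ₑ = ‖inner 𝕜 y x‖ₑ := by
  rw [← ofReal_norm, norm_inner_symm, ofReal_norm]

variable (𝕜) in
/-- The absolute value of the product `⟨f_i, g_k⟩ ⟨g̃_k, f̃_i⟩`. These products add up to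
`⟨f_i, f̃_i⟩` over `k` and to `⟨g̃_k, g_k⟩` over `i`. -/
noncomputable def crossWeight (f : ι → H) (g : κ → H) (i : ι) (k : κ) : ℝ≥0∞ :=
  ‖inner 𝕜 (f i) (g k)‖ₑ * ‖inner 𝕜 (canonicalDual 𝕜 g k) (canonicalDual 𝕜 f i)‖ₑ

theorem crossWeight_comm (i : ι) (k : κ) : crossWeight 𝕜 f g i k = crossWeight 𝕜 g f k i := by
  rw [crossWeight, crossWeight, enorm_inner_symm, enorm_inner_symm (canonicalDual 𝕜 g k)]

theorem enorm_sub_sum_le {t : κ → 𝕜} {r : 𝕜} (h : HasSum t r) (s : Finset κ) :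
    ‖r - ∑ k ∈ s, t k‖ₑ ≤ ∑' k : ↥(s : Set κ)ᶜ, ‖t k‖ₑ := by
  have tail : HasSum (fun k : ↥(s : Set κ)ᶜ => t k) (r - ∑ k ∈ s, t k) :=
    s.hasSum_compl_iff.2 (by rwa [sub_add_cancel])
  exact tail.enorm_le_of_bounded ENNReal.summable.hasSum fun _ => le_rfl

theorem enorm_sum_le_add_of_hasSum {t : ι → κ → 𝕜} {r : ι → 𝕜} {c : κ → 𝕜}
    (hr : ∀ i, HasSum (t i) (r i)) (hc : ∀ k, HasSum (fun i => t i k) (c k)) (s : Finset ι)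
    (s' : Finset κ) : ‖∑ i ∈ s, r i‖ₑ ≤ ‖∑ k ∈ s', c k‖ₑ +
      (∑ i ∈ s, ∑' k : ↥(s' : Set κ)ᶜ, ‖t i k‖ₑ + ∑ k ∈ s', ∑' i : ↥(s : Set ι)ᶜ, ‖t i k‖ₑ) := by
  have decompose : ∑ i ∈ s, r i = ∑ k ∈ s', c k + (∑ i ∈ s, (r i - ∑ k ∈ s', t i k) -
      ∑ k ∈ s', (c k - ∑ i ∈ s, t i k)) := by
    rw [Finset.sum_sub_distrib, Finset.sum_sub_distrib, Finset.sum_comm (s := s')]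
    ring
  calc ‖∑ i ∈ s, r i‖ₑ
      ≤ ‖∑ k ∈ s', c k‖ₑ + (‖∑ i ∈ s, (r i - ∑ k ∈ s', t i k)‖ₑ +
          ‖∑ k ∈ s', (c k - ∑ i ∈ s, t i k)‖ₑ) := by
        rw [decompose]
        exact (enorm_add_le _ _).trans (by gcongr; exact enorm_sub_le)
    _ ≤ _ := by
        gcongr
        · exact (enorm_sum_le _ _).trans (Finset.sum_le_sum fun i _ => enorm_sub_sum_le (hr i) s')
        · exact (enorm_sum_le _ _).trans (Finset.sum_le_sum fun k _ => enorm_sub_sum_le (hc k) s)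

variable [CompleteSpace H]

theorem IsFrame.hasSum_inner' (hf : IsFrame 𝕜 f) (x y : H) :
    HasSum (fun i => inner 𝕜 x (f i) * inner 𝕜 (canonicalDual 𝕜 f i) y) (inner 𝕜 x y) := by
  have h := (hf.hasSum_inner y x).star
  simpa only [star_mul', RCLike.star_def, inner_conj_symm, mul_comm] using h

theorem IsFrame.sum_dualPairing (hf : IsFrame 𝕜 f) (s : Finset ι) :
    ∑ i ∈ s, dualPairing 𝕜 f i = ‖∑ i ∈ s, inner 𝕜 (f i) (canonicalDual 𝕜 f i)‖ₑ := by
  simp_rw [← hf.inner_analysis_canonicalDual, inner_self_eq_norm_sq_to_K,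
    hf.dualPairing_eq_enorm_sq]
  norm_cast
  rw [← ofReal_norm, RCLike.norm_ofReal, abs_of_nonneg (by positivity),
    ENNReal.ofReal_sum_of_nonneg fun _ _ => by positivity]
  simp_rw [ENNReal.ofReal_pow (norm_nonneg _), ofReal_norm]

theorem IsFrame.tsum_dualPairing_le (hf : IsFrame 𝕜 f) (hg : IsFrame 𝕜 g) {s : Set ι} {s' : Set κ}
    (hs : s.Finite) (hs' : s'.Finite) : ∑' i : s, dualPairing 𝕜 f i ≤ ∑' k : s', dualPairing 𝕜 g k +
      (∑' i : s, ∑' k : ↥s'ᶜ, crossWeight 𝕜 f g i k +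
        ∑' k : s', ∑' i : ↥sᶜ, crossWeight 𝕜 g f k i) := by
  lift s to Finset ι using hs
  lift s' to Finset κ using hs'
  have total_row (i : ι) := hg.hasSum_inner' (f i) (canonicalDual 𝕜 f i)
  have total_column (k : κ) : HasSum
      (fun i => inner 𝕜 (f i) (g k) * inner 𝕜 (canonicalDual 𝕜 g k) (canonicalDual 𝕜 f i))
      (inner 𝕜 (g k) (canonicalDual 𝕜 g k)) := by
    simpa only [mul_comm, hg.inner_canonicalDual_left] using
      hf.hasSum_inner (canonicalDual 𝕜 g k) (g k)
  have h := enorm_sum_le_add_of_hasSum total_row total_column s s'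
  simp only [← hf.sum_dualPairing, ← hg.sum_dualPairing, enorm_mul] at h
  simp only [crossWeight_comm (f := g)]
  rwa [Finset.tsum_subtype' s fun i => dualPairing 𝕜 f i,
    Finset.tsum_subtype' s' fun k => dualPairing 𝕜 g k,
    Finset.tsum_subtype' s fun i => ∑' k : ↥(s' : Set κ)ᶜ, crossWeight 𝕜 f g i k,
    Finset.tsum_subtype' s' fun k => ∑' i : ↥(s : Set ι)ᶜ, crossWeight 𝕜 f g i k]

variable {d e : ℕ} {n : Fin e → ℕ} {α : Fin d → ℝ} {a : ι → RefGroup d n} {b : κ → RefGroup d n}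

theorem IsFrame.isLocalized_crossWeight (hf : IsFrame 𝕜 f) (hg : IsFrame 𝕜 g)
    (h : ∀ ε : ℝ, 0 < ε → ∃ M, ∀ i,
      ∑' k : ↥(preBox α b M (a i))ᶜ, ‖inner 𝕜 (f i) (g k)‖ₑ ^ 2 ≤ ENNReal.ofReal ε) :
    IsLocalized α a b (crossWeight 𝕜 f g) := by
  obtain ⟨C, hC⟩ := hg.isBessel.exists_tsum_inner_sq_le hf.isBessel
  obtain ⟨P, hP⟩ := hg.isBessel_canonicalDual.exists_tsum_inner_sq_le hf.isBessel_canonicalDual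
  refine IsLocalized.mul ⟨⟨C, fun i => ?_⟩, fun δ hδ => ?_⟩ hP
  · simpa only [enorm_inner_symm (f i)] using hC i
  · simpa only [ENNReal.ofReal_coe_nnreal] using h δ hδ

theorem RowDecay.isLocalized {g : RefGroup d n → H} (h : RowDecay 𝕜 α a f g) (hf : IsFrame 𝕜 f)
    (hg : IsFrame 𝕜 g) : IsLocalized α a id (crossWeight 𝕜 f g) := by
  refine hf.isLocalized_crossWeight hg fun ε hε => ?_
  obtain ⟨M, -, hM⟩ := h ε hε
  simp only [enorm_inner_symm (f _)]
  exact ⟨M, fun i => (hM i).le⟩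

theorem ColumnDecay.isLocalized {g : RefGroup d n → H} (h : ColumnDecay 𝕜 α a f g)
    (hf : IsFrame 𝕜 f) (hg : IsFrame 𝕜 g) : IsLocalized α id a (crossWeight 𝕜 g f) := by
  refine hg.isLocalized_crossWeight hf fun ε hε => ?_
  obtain ⟨M, -, hM⟩ := h ε hε
  exact ⟨M, fun j => (hM j).le⟩

end Comparison

section Averages

variable {𝕜 : Type*} [RCLike 𝕜] {H : Type*} [NormedAddCommGroup H] [InnerProductSpace 𝕜 H]
  {ι κ : Type*} {f : ι → H} {g : κ → H} {d e : ℕ} {n : Fin e → ℕ} [∀ l, NeZero (n l)]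
  {α : Fin d → ℝ} {a : ι → RefGroup d n} {b : κ → RefGroup d n}

theorem boxDensity_mul_boxAverage (hα : ∀ i, 0 < α i) {N : ℕ} {j : RefGroup d n}
    (h : (preBox α a N j).Finite) : boxDensity α a N j * boxAverage 𝕜 α a f N j =
      (∑' i : preBox α a N j, dualPairing 𝕜 f i) / boxCard α n N := by
  rw [boxDensity, boxAverage, encard_box hα, ENat.toENNReal_coe]
  rcases (preBox α a N j).eq_empty_or_nonempty with h₀ | h₀
  · have : IsEmpty (preBox α a N j) := Set.isEmpty_coe_sort.2 h₀
    simp [h₀]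
  · have encard_ne_zero : ((preBox α a N j).encard : ℝ≥0∞) ≠ 0 := by simpa using h₀.ne_empty
    have encard_ne_top : ((preBox α a N j).encard : ℝ≥0∞) ≠ ∞ := by simpa using h
    rw [mul_comm, ← mul_div_assoc, ENNReal.div_mul_cancel encard_ne_zero encard_ne_top]

theorem boxDensity_id (hα : ∀ i, 0 < α i) (N : ℕ) (j : RefGroup d n) :
    boxDensity α id N j = 1 := by
  rw [boxDensity]
  change ((box α N j).encard : ℝ≥0∞) / (box α N j).encard = 1
  rw [encard_box hα, ENat.toENNReal_coe]
  exact ENNReal.div_self (Nat.cast_ne_zero.2 (boxCard_pos hα N).ne') (ENNReal.natCast_ne_top _)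

variable [CompleteSpace H]

theorem eventually_boxDensity_mul_boxAverage_le (hα : ∀ i, 0 < α i) (hf : IsFrame 𝕜 f)
    (hg : IsFrame 𝕜 g) {K : ℕ}
    (ha : ∀ j, (a ⁻¹' {j}).encard ≤ K) (hb : ∀ j, (b ⁻¹' {j}).encard ≤ K)
    (hab : IsLocalized α a b (crossWeight 𝕜 f g)) (hba : IsLocalized α b a (crossWeight 𝕜 g f))
    {ε : ℝ≥0} (hε : 0 < ε) :
    ∀ᶠ N in atTop, ∀ j, boxDensity α a N j * boxAverage 𝕜 α a f N j ≤
      boxDensity α b N j * boxAverage 𝕜 α b g N j + ε := by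
  filter_upwards [hab.eventually_leakage_le hα ha (half_pos hε),
    hba.eventually_leakage_le hα hb (half_pos hε)] with N hN hN' j
  have preBox_finite_a := preBox_finite hα ha N j
  have preBox_finite_b := preBox_finite hα hb N j
  rw [boxDensity_mul_boxAverage hα preBox_finite_a, boxDensity_mul_boxAverage hα preBox_finite_b]
  have boxCard_ne_zero : (boxCard α n N : ℝ≥0∞) ≠ 0 := Nat.cast_ne_zero.2 (boxCard_pos hα N).ne'
  refine ENNReal.div_le_of_le_mul ?_
  rw [add_mul, ENNReal.div_mul_cancel boxCard_ne_zero (ENNReal.natCast_ne_top _)]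
  refine (hf.tsum_dualPairing_le hg preBox_finite_a preBox_finite_b).trans ?_
  gcongr
  refine (add_le_add (hN j) (hN' j)).trans_eq ?_
  rw [← add_mul, ← ENNReal.coe_add, add_halves]

end Averages

/-! ### Limits along free ultrafilters -/

section UltrafilterLimits

variable {X β : Type*} [CompleteLinearOrder β]

/-- The upper limit of a sequence of functions, in the sense of uniform densities: the upper limit
of the suprema. The upper density and the upper measure are of this form. -/
def upperLim (u : ℕ → X → β) : β :=
  limsup (fun N => ⨆ j, u N j) atTop

/-- The lower limit of a sequence of functions, in the sense of uniform densities: the lower limit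
of the infima. The lower density and the lower measure are of this form. -/
def lowerLim (u : ℕ → X → β) : β :=
  liminf (fun N => ⨅ j, u N j) atTop

theorem IsFree.le_atTop {p : Ultrafilter ℕ} (hp : IsFree p) : (p : Filter ℕ) ≤ atTop := by
  rw [← Nat.cofinite_eq_atTop]
  exact hp

section Order

variable [TopologicalSpace β] [OrderTopology β]

theorem le_upperLim_of_tendsto {p : Ultrafilter ℕ} (hp : IsFree p) {u : ℕ → X → β}
    {c : ℕ → X} {b : β} (h : Tendsto (fun N => u N (c N)) p (𝓝 b)) : b ≤ upperLim u := by
  rw [← h.limsup_eq]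
  refine (limsup_le_limsup (Eventually.of_forall fun N => le_iSup (u N) (c N))).trans ?_
  exact limsup_le_limsup_of_le hp.le_atTop

theorem exists_eventually_lt_of_lt_upperLim [DenselyOrdered β] [FirstCountableTopology β]
    [Nonempty X] (u : ℕ → X → β) : ∃ (p : Ultrafilter ℕ) (c : ℕ → X), IsFree p ∧
      ∀ b < upperLim u, ∀ᶠ N in (p : Filter ℕ), b < u N (c N) := by
  rcases eq_bot_or_bot_lt (upperLim u) with h_bot | h_bot
  · exact ⟨hyperfilter ℕ, fun _ => Classical.arbitrary X, hyperfilter_le_cofinite,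
      fun b hb => absurd (h_bot ▸ hb) not_lt_bot⟩
  obtain ⟨b, -, hb, b_tendsto⟩ := exists_seq_strictMono_tendsto' h_bot
  have frequently_lt (m : ℕ) : ∃ᶠ N in atTop, ∃ j, b m < u N j :=
    (frequently_lt_of_lt_limsup (h := (hb m).2)).mono fun N hN => lt_iSup_iff.1 hN
  obtain ⟨φ, φ_mono, hφ⟩ := extraction_forall_of_frequently frequently_lt
  choose j hj using hφ
  refine ⟨Ultrafilter.of (map φ atTop), fun N => j (Function.invFun φ N), ?_, fun x hx => ?_⟩
  · refine (Ultrafilter.of_le _).trans ?_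
    rw [Nat.cofinite_eq_atTop]
    exact φ_mono.tendsto_atTop
  · refine (Ultrafilter.of_le (map φ atTop) : _ ≤ _) ?_
    rw [mem_map]
    filter_upwards [b_tendsto.eventually (lt_mem_nhds hx)] with m hm
    simp only [Set.mem_preimage, Set.mem_ofPred_eq,
      Function.leftInverse_invFun φ_mono.injective m]
    exact hm.trans (hj m)

theorem exists_isFree_tendsto_upperLim [DenselyOrdered β] [FirstCountableTopology β]
    [Nonempty X] (u : ℕ → X → β) : ∃ (p : Ultrafilter ℕ) (c : ℕ → X), IsFree p ∧
      Tendsto (fun N => u N (c N)) p (𝓝 (upperLim u)) := by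
  obtain ⟨p, c, hp, h⟩ := exists_eventually_lt_of_lt_upperLim u
  refine ⟨p, c, hp, tendsto_order.2 ⟨h, fun b hb => ?_⟩⟩
  have iSup_lt : ∀ᶠ N in atTop, ⨆ j, u N j < b := eventually_lt_of_limsup_lt hb
  filter_upwards [iSup_lt.filter_mono hp.le_atTop] with N hN
  exact (le_iSup (u N) (c N)).trans_lt hN

end Order

variable {u v w : ℕ → X → ℝ≥0∞} {p : Ultrafilter ℕ} {c : ℕ → X}

theorem pLim_eq {x : ℕ → ℝ≥0∞} {b : ℝ≥0∞} (h : Tendsto x p (𝓝 b)) : pLim p x = b :=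
  tendsto_nhds_unique (tendsto_pLim p x) h

theorem pLim_le_upperLim (hp : IsFree p) : pLim p (fun N => u N (c N)) ≤ upperLim u :=
  le_upperLim_of_tendsto hp (tendsto_pLim p _)

theorem lowerLim_le_pLim (hp : IsFree p) : lowerLim u ≤ pLim p (fun N => u N (c N)) :=
  le_upperLim_of_tendsto (β := ℝ≥0∞ᵒᵈ) hp (tendsto_pLim p _)

variable [Nonempty X]

theorem exists_isFree_pLim_eq_upperLim (u : ℕ → X → ℝ≥0∞) :
    ∃ (p : Ultrafilter ℕ) (c : ℕ → X), IsFree p ∧ pLim p (fun N => u N (c N)) = upperLim u := by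
  obtain ⟨p, c, hp, h⟩ := exists_isFree_tendsto_upperLim u
  exact ⟨p, c, hp, pLim_eq h⟩

theorem exists_isFree_pLim_eq_lowerLim (u : ℕ → X → ℝ≥0∞) :
    ∃ (p : Ultrafilter ℕ) (c : ℕ → X), IsFree p ∧ pLim p (fun N => u N (c N)) = lowerLim u := by
  obtain ⟨p, c, hp, h⟩ := exists_isFree_tendsto_upperLim (β := ℝ≥0∞ᵒᵈ) u
  exact ⟨p, c, hp, pLim_eq h⟩

theorem upperLim_eq_of_eventually_eq {b : ℝ≥0∞} (h : ∀ᶠ N in atTop, ∀ j, u N j = b) :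
    upperLim u = b := by
  refine (limsup_congr ?_).trans (limsup_const b)
  filter_upwards [h] with N hN
  simp only [hN, ciSup_const]

theorem lowerLim_eq_of_eventually_eq {b : ℝ≥0∞} (h : ∀ᶠ N in atTop, ∀ j, u N j = b) :
    lowerLim u = b := by
  refine (liminf_congr ?_).trans (liminf_const b)
  filter_upwards [h] with N hN
  simp only [hN, ciInf_const]

theorem pLim_eq_of_eventually_eq {b : ℝ≥0∞} (h : ∀ᶠ N in atTop, ∀ j, u N j = b) (hp : IsFree p) :
    pLim p (fun N => u N (c N)) = b :=
  le_antisymm ((pLim_le_upperLim hp).trans_eq (upperLim_eq_of_eventually_eq h))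
    ((lowerLim_eq_of_eventually_eq h).symm.trans_le (lowerLim_le_pLim hp))

/-- The limits of `w` along all free ultrafilters and all sequences of centers are the products of
the limits of `u` and `v`. It is the relation between the measure of the reference frame (`w`), the
density (`u`) and the measure of the localized frame (`v`). -/
def IsLimMul (u v w : ℕ → X → ℝ≥0∞) : Prop :=
  ∀ (p : Ultrafilter ℕ) (c : ℕ → X), IsFree p →
    pLim p (fun N => w N (c N)) = pLim p (fun N => u N (c N)) * pLim p fun N => v N (c N)

namespace IsLimMul

omit [Nonempty X] in
theorem symm (h : IsLimMul u v w) : IsLimMul v u w :=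
  fun p c hp => (h p c hp).trans (mul_comm _ _)

theorem lowerLim_le (h : IsLimMul u v w) : lowerLim w ≤ upperLim u * lowerLim v := by
  obtain ⟨p, c, hp, hv⟩ := exists_isFree_pLim_eq_lowerLim v
  calc lowerLim w ≤ pLim p fun N => w N (c N) := lowerLim_le_pLim hp
    _ = (pLim p fun N => u N (c N)) * lowerLim v := by rw [h p c hp, hv]
    _ ≤ upperLim u * lowerLim v := mul_le_mul_left (pLim_le_upperLim hp) _

theorem le_upperLim (h : IsLimMul u v w) : upperLim u * lowerLim v ≤ upperLim w := by
  obtain ⟨p, c, hp, hu⟩ := exists_isFree_pLim_eq_upperLim u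
  calc upperLim u * lowerLim v ≤ upperLim u * pLim p fun N => v N (c N) :=
        mul_le_mul_right (lowerLim_le_pLim hp) _
    _ = pLim p fun N => w N (c N) := by rw [h p c hp, hu]
    _ ≤ upperLim w := pLim_le_upperLim hp

theorem pLim_eq_one_div (h : IsLimMul u v w) (hw : ∀ᶠ N in atTop, ∀ j, w N j = 1)
    (p : Ultrafilter ℕ) (c : ℕ → X) (hp : IsFree p) :
    pLim p (fun N => v N (c N)) = 1 / pLim p fun N => u N (c N) := by
  rw [one_div]
  exact ENNReal.eq_inv_of_mul_eq_one_left
    ((h.symm p c hp).symm.trans (pLim_eq_of_eventually_eq hw hp))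

theorem upperLim_mul_lowerLim (h : IsLimMul u v w) (hw : ∀ᶠ N in atTop, ∀ j, w N j = 1) :
    upperLim u * lowerLim v = 1 :=
  le_antisymm (h.le_upperLim.trans_eq (upperLim_eq_of_eventually_eq hw))
    ((lowerLim_eq_of_eventually_eq hw).symm.trans_le h.lowerLim_le)

theorem lowerLim_eq_one_div (h : IsLimMul u v w) (hw : ∀ᶠ N in atTop, ∀ j, w N j = 1) :
    lowerLim v = 1 / upperLim u := by
  rw [one_div]
  exact ENNReal.eq_inv_of_mul_eq_one_left ((mul_comm _ _).trans (h.upperLim_mul_lowerLim hw))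

theorem upperLim_eq_one_div (h : IsLimMul u v w) (hw : ∀ᶠ N in atTop, ∀ j, w N j = 1) :
    upperLim v = 1 / lowerLim u := by
  rw [one_div]
  exact ENNReal.eq_inv_of_mul_eq_one_left (h.symm.upperLim_mul_lowerLim hw)

theorem one_le_lowerLim (h : IsLimMul u v w) (hw : ∀ᶠ N in atTop, ∀ j, w N j = 1)
    (hv : upperLim v ≤ 1) : 1 ≤ lowerLim u := by
  rw [← h.symm.upperLim_mul_lowerLim hw]
  exact mul_le_of_le_one_left' hv

theorem pLim_eq_one (h : IsLimMul u v w) (hw : ∀ᶠ N in atTop, ∀ j, w N j = 1)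
    (hv : ∀ᶠ N in atTop, ∀ j, v N j = 1) (hp : IsFree p) : pLim p (fun N => u N (c N)) = 1 := by
  rw [h.symm.pLim_eq_one_div hw p c hp, pLim_eq_of_eventually_eq hv hp, div_one]

theorem lowerLim_eq_one (h : IsLimMul u v w) (hw : ∀ᶠ N in atTop, ∀ j, w N j = 1)
    (hv : ∀ᶠ N in atTop, ∀ j, v N j = 1) : lowerLim u = 1 := by
  rw [h.symm.lowerLim_eq_one_div hw, upperLim_eq_of_eventually_eq hv, div_one]

theorem upperLim_eq_one (h : IsLimMul u v w) (hw : ∀ᶠ N in atTop, ∀ j, w N j = 1)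
    (hv : ∀ᶠ N in atTop, ∀ j, v N j = 1) : upperLim u = 1 := by
  rw [h.symm.upperLim_eq_one_div hw, lowerLim_eq_of_eventually_eq hv, div_one]

end IsLimMul

end UltrafilterLimits

/-! ### Density and measure -/

section Averages

variable {𝕜 : Type*} [RCLike 𝕜] {H : Type*} [NormedAddCommGroup H] [InnerProductSpace 𝕜 H]
  {ι : Type*} {f : ι → H} {d e : ℕ} {n : Fin e → ℕ} {α : Fin d → ℝ} {a : ι → RefGroup d n}
  {p : Ultrafilter ℕ} {c : ℕ → RefGroup d n}

theorem tendsto_encard_preBox [∀ l, NeZero (n l)] (hd : 0 < d) (hα : ∀ i, 0 < α i)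
    (hp : IsFree p) (hpos : density α a p c ≠ 0) :
    Tendsto (fun N => ((preBox α a N (c N)).encard : ℝ≥0∞)) p (𝓝 ∞) := by
  have boxCard_tendsto : Tendsto (fun N => (boxCard α n N : ℝ≥0∞)) p (𝓝 ∞) :=
    ENNReal.tendsto_nat_nhds_top.comp ((tendsto_boxCard_atTop hd hα).mono_left hp.le_atTop)
  have h := ENNReal.Tendsto.mul (tendsto_pLim p fun N => boxDensity α a N (c N))
    (Or.inl hpos) boxCard_tendsto (Or.inl ENNReal.top_ne_zero)
  refine (h.congr fun N => ?_).mono_right (congrArg 𝓝 (ENNReal.mul_top hpos)).le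
  rw [boxDensity, encard_box hα, ENat.toENNReal_coe, ENNReal.div_mul_cancel
    (Nat.cast_ne_zero.2 (boxCard_pos hα N).ne') (ENNReal.natCast_ne_top _)]

theorem le_boxAverage_add {L : ℝ≥0∞} {N : ℕ} {j : RefGroup d n} (hne : (preBox α a N j).Nonempty)
    (hfin : (preBox α a N j).Finite) : L ≤ boxAverage 𝕜 α a f N j +
      {i | dualPairing 𝕜 f i < L}.encard * L / (preBox α a N j).encard := by
  set Q := preBox α a N j with hQ
  set T := {i | dualPairing 𝕜 f i < L}
  rw [boxAverage, ← hQ, ENNReal.div_add_div_same,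
    ENNReal.le_div_iff_mul_le (Or.inl (by simpa using hne.ne_empty)) (Or.inl (by simpa using hfin))]
  calc L * Q.encard = ∑' _ : Q, L := by rw [ENNReal.tsum_set_const, mul_comm]
    _ ≤ ∑' _ : ↥(Q \ T), L + ∑' _ : T, L := by
        refine le_trans ?_ (ENNReal.tsum_union_le (fun _ => L) (Q \ T) T)
        rw [Set.sdiff_union_self]
        exact ENNReal.tsum_mono_subtype (fun _ => L) Set.subset_union_left
    _ ≤ ∑' i : Q, dualPairing 𝕜 f i + T.encard * L := by
        rw [ENNReal.tsum_set_const T]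
        gcongr
        refine (ENNReal.tsum_le_tsum fun i : ↥(Q \ T) => ?_).trans
          (ENNReal.tsum_mono_subtype (dualPairing 𝕜 f) Set.sdiff_subset)
        exact not_lt.1 i.2.2

theorem infinite_setOf_dualPairing_lt [∀ l, NeZero (n l)] (hd : 0 < d) (hα : ∀ i, 0 < α i)
    (hfin : ∀ N j, (preBox α a N j).Finite) (hp : IsFree p) (hpos : density α a p c ≠ 0)
    {L : ℝ≥0∞} (hL : L ≠ ∞) (hlt : frameMeasure 𝕜 α a f p c < L) :
    {i | dualPairing 𝕜 f i < L}.Infinite := by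
  intro finite
  set T := {i | dualPairing 𝕜 f i < L}
  have encard_tendsto := tendsto_encard_preBox hd hα hp hpos
  have exceptions_tendsto : Tendsto (fun N => T.encard * L / (preBox α a N (c N)).encard) p
      (𝓝 (T.encard * L / ∞)) :=
    ENNReal.Tendsto.const_div encard_tendsto
      (Or.inr (ENNReal.mul_ne_top (by simpa using finite) hL))
  have bound_tendsto := (tendsto_pLim p fun N => boxAverage 𝕜 α a f N (c N)).add exceptions_tendsto
  rw [ENNReal.div_top, add_zero] at bound_tendsto
  refine hlt.not_ge (ge_of_tendsto bound_tendsto ?_)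
  filter_upwards [encard_tendsto.eventually_ne ENNReal.top_ne_zero] with N hN
  exact le_boxAverage_add (Set.nonempty_iff_ne_empty.2 (by simpa using hN)) (hfin N _)

theorem boxAverage_eq_one (h : ∀ i, dualPairing 𝕜 f i = 1) {N : ℕ} {j : RefGroup d n}
    (hne : (preBox α a N j).Nonempty) (hfin : (preBox α a N j).Finite) :
    boxAverage 𝕜 α a f N j = 1 := by
  simp only [boxAverage, h, ENNReal.tsum_set_one]
  exact ENNReal.div_self (by simpa using hne.ne_empty) (by simpa using hfin)

theorem eventually_preBox_nonempty (h : lowerDensity α a ≠ 0) :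
    ∀ᶠ N in atTop, ∀ j, (preBox α a N j).Nonempty := by
  filter_upwards [eventually_lt_of_lt_liminf (pos_iff_ne_zero.2 h)] with N hN j
  rw [Set.nonempty_iff_ne_empty]
  intro preBox_empty
  have density_pos : 0 < boxDensity α a N j := hN.trans_le (iInf_le _ j)
  simp [boxDensity, preBox_empty] at density_pos

theorem eventually_boxAverage_eq_one (h : ∀ i, dualPairing 𝕜 f i = 1)
    (hfin : ∀ N j, (preBox α a N j).Finite) (hpos : lowerDensity α a ≠ 0) :
    ∀ᶠ N in atTop, ∀ j, boxAverage 𝕜 α a f N j = 1 :=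
  (eventually_preBox_nonempty hpos).mono fun N hN j => boxAverage_eq_one h (hN j) (hfin N j)

variable [CompleteSpace H]

theorem IsFrame.upperMeasure_le_one (hf : IsFrame 𝕜 f) : upperMeasure 𝕜 α a f ≤ 1 := by
  refine limsup_le_of_le (h := Eventually.of_forall fun N => iSup_le fun j => ?_)
  refine ENNReal.div_le_of_le_mul ?_
  rw [one_mul, ← ENNReal.tsum_set_one]
  exact ENNReal.tsum_le_tsum fun i => hf.dualPairing_le_one i

variable [∀ l, NeZero (n l)] {g : RefGroup d n → H}

theorem eventually_boxAverage_near (hα : ∀ i, 0 < α i) (hf : IsFrame 𝕜 f) (hg : IsFrame 𝕜 g)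
    (hD : upperDensity α a < ∞) (hcol : ColumnDecay 𝕜 α a f g) (hrow : RowDecay 𝕜 α a f g)
    {ε : ℝ≥0} (hε : 0 < ε) : ∀ᶠ N in atTop, ∀ j,
      boxAverage 𝕜 α id g N j ≤ boxDensity α a N j * boxAverage 𝕜 α a f N j + ε ∧
      boxDensity α a N j * boxAverage 𝕜 α a f N j ≤ boxAverage 𝕜 α id g N j + ε := by
  obtain ⟨K, hK⟩ := exists_encard_fiber_le hα hD
  have fiber_a_le (j : RefGroup d n) : (a ⁻¹' {j}).encard ≤ (max K 1 : ℕ) :=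
    (hK j).trans (by exact_mod_cast le_max_left K 1)
  have fiber_id_le (j : RefGroup d n) : (id ⁻¹' {j}).encard ≤ (max K 1 : ℕ) := by
    rw [Set.preimage_id, Set.encard_singleton]
    exact_mod_cast le_max_right K 1
  have rows := hrow.isLocalized hf hg
  have columns := hcol.isLocalized hf hg
  filter_upwards [
    eventually_boxDensity_mul_boxAverage_le hα hg hf fiber_id_le fiber_a_le columns rows hε,
    eventually_boxDensity_mul_boxAverage_le hα hf hg fiber_a_le fiber_id_le rows columns hε]
    with N upper lower j
  have h := And.intro (upper j) (lower j)
  rwa [boxDensity_id hα, one_mul] at h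

theorem isLimMul_boxDensity_boxAverage (hα : ∀ i, 0 < α i) (hf : IsFrame 𝕜 f) (hg : IsFrame 𝕜 g)
    (hD : upperDensity α a < ∞) (hcol : ColumnDecay 𝕜 α a f g) (hrow : RowDecay 𝕜 α a f g) :
    IsLimMul (boxDensity α a) (boxAverage 𝕜 α a f) (boxAverage 𝕜 α id g) := by
  intro p c hp
  have density_ne_top : density α a p c ≠ ∞ := ((pLim_le_upperLim hp).trans_lt hD).ne
  have measure_ne_top : frameMeasure 𝕜 α a f p c ≠ ∞ :=
    (((pLim_le_upperLim hp).trans hf.upperMeasure_le_one).trans_lt ENNReal.one_lt_top).ne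
  have g_tendsto := tendsto_pLim p fun N => boxAverage 𝕜 α id g N (c N)
  have f_tendsto := ENNReal.Tendsto.mul (tendsto_pLim p fun N => boxDensity α a N (c N))
    (Or.inr measure_ne_top) (tendsto_pLim p fun N => boxAverage 𝕜 α a f N (c N))
    (Or.inr density_ne_top)
  have near {ε : ℝ≥0} (hε : 0 < ε) :=
    (eventually_boxAverage_near hα hf hg hD hcol hrow hε).filter_mono hp.le_atTop
  refine le_antisymm ?_ ?_ <;> refine ENNReal.le_of_forall_pos_le_add fun ε hε _ => ?_
  · exact le_of_tendsto_of_tendsto g_tendsto (f_tendsto.add_const _)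
      ((near hε).mono fun N h => (h (c N)).1)
  · exact le_of_tendsto_of_tendsto f_tendsto (g_tendsto.add_const _)
      ((near hε).mono fun N h => (h (c N)).2)

theorem exists_infinite_isFrame_compl_of_upperMeasure_lt (hd : 0 < d) (hα : ∀ i, 0 < α i)
    (hf : IsFrame 𝕜 f) (hg : IsFrame 𝕜 g) (hD : upperDensity α a < ∞)
    (hcol : ColumnDecay 𝕜 α a f g) (hrow : RowDecay 𝕜 α a f g)
    (hlt : upperMeasure 𝕜 α id g < upperDensity α a) :
    ∃ J : Set ι, J.Infinite ∧ IsFrame 𝕜 fun i : ↥Jᶜ => f i := by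
  obtain ⟨K, hK⟩ := exists_encard_fiber_le hα hD
  obtain ⟨p, c, hp, density_eq⟩ := exists_isFree_pLim_eq_upperLim (boxDensity α a)
  change density α a p c = upperDensity α a at density_eq
  have measure_lt_one : frameMeasure 𝕜 α a f p c < 1 := by
    by_contra! one_le
    refine hlt.not_ge ?_
    calc upperDensity α a ≤ density α a p c * frameMeasure 𝕜 α a f p c := by
          rw [density_eq]
          exact le_mul_of_one_le_right' one_le
      _ = frameMeasure 𝕜 α id g p c :=
          (isLimMul_boxDensity_boxAverage hα hf hg hD hcol hrow p c hp).symm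
      _ ≤ upperMeasure 𝕜 α id g := pLim_le_upperLim hp
  obtain ⟨L, hL, hL_one⟩ := exists_between measure_lt_one
  exact hf.exists_infinite_isFrame_compl hL_one <| infinite_setOf_dualPairing_lt hd hα
    (preBox_finite hα hK) hp (density_eq ▸ hlt.ne_bot) hL_one.ne_top hL

end Averages

end FrameDensity

theorem theorem3p4
    {𝕜 : Type*} [RCLike 𝕜]
    {H : Type*} [NormedAddCommGroup H] [InnerProductSpace 𝕜 H] [CompleteSpace H]
    [TopologicalSpace.SeparableSpace H]
    -- the reference group `G = ∏ α_i ℤ × ∏ ℤ_{n_l}`, with at least one infinite factor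
    {d e : ℕ} (hd : 0 < d) (α : Fin d → ℝ) (hα : ∀ i, 0 < α i)
    (n : Fin e → ℕ) (hn : ∀ l, 0 < n l)
    -- the index set `I` with its map `a : I → G`, and the frames `F = (F i)`, `E = (E j)`
    {I : Type*} [Countable I] (a : I → RefGroup d n)
    (F : I → H) (E : RefGroup d n → H)
    (hF : IsFrame 𝕜 F) (hE : IsFrame 𝕜 E)
    (hD : upperDensity α a < ⊤)
    (hcol : ColumnDecay 𝕜 α a F E) (hrow : RowDecay 𝕜 α a F E) :
    -- (a)
    (∀ (p : Ultrafilter ℕ) (c : ℕ → RefGroup d n), IsFree p →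
      frameMeasure 𝕜 α id E p c = density α a p c * frameMeasure 𝕜 α a F p c) ∧
    (lowerMeasure 𝕜 α id E ≤ upperDensity α a * lowerMeasure 𝕜 α a F ∧
      upperDensity α a * lowerMeasure 𝕜 α a F ≤ upperMeasure 𝕜 α id E) ∧
    (lowerMeasure 𝕜 α id E ≤ lowerDensity α a * upperMeasure 𝕜 α a F ∧
      lowerDensity α a * upperMeasure 𝕜 α a F ≤ upperMeasure 𝕜 α id E) ∧
    -- (b)
    (upperMeasure 𝕜 α id E < upperDensity α a →
      ∃ J : Set I, J.Infinite ∧ IsFrame 𝕜 (fun i : ↥Jᶜ => F i)) ∧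
    (IsRieszBasis 𝕜 E →
      -- (c)
      (∀ (p : Ultrafilter ℕ) (c : ℕ → RefGroup d n), IsFree p →
        frameMeasure 𝕜 α a F p c = 1 / density α a p c) ∧
      lowerMeasure 𝕜 α a F = 1 / upperDensity α a ∧
      upperMeasure 𝕜 α a F = 1 / lowerDensity α a ∧
      -- (d)
      1 ≤ lowerDensity α a ∧
      -- (e)
      (1 < upperDensity α a →
        ∃ J : Set I, J.Infinite ∧ IsFrame 𝕜 (fun i : ↥Jᶜ => F i)) ∧
      -- (f)
      (IsRieszBasis 𝕜 F →
        lowerDensity α a = 1 ∧ upperDensity α a = 1 ∧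
        lowerMeasure 𝕜 α a F = 1 ∧ upperMeasure 𝕜 α a F = 1 ∧
        ∀ (p : Ultrafilter ℕ) (c : ℕ → RefGroup d n), IsFree p →
          density α a p c = 1 ∧ frameMeasure 𝕜 α a F p c = 1)) := by
  have : ∀ l, NeZero (n l) := fun l => ⟨(hn l).ne'⟩
  have hlim := isLimMul_boxDensity_boxAverage hα hF hE hD hcol hrow
  have removable := exists_infinite_isFrame_compl_of_upperMeasure_lt hd hα hF hE hD hcol hrow
  refine ⟨hlim, ⟨hlim.lowerLim_le, hlim.le_upperLim⟩,
    ⟨hlim.symm.lowerLim_le.trans_eq (mul_comm _ _),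
      (mul_comm _ _).trans_le hlim.symm.le_upperLim⟩, removable, fun hER => ?_⟩
  have average_E : ∀ᶠ N in Filter.atTop, ∀ j, boxAverage 𝕜 α id E N j = 1 :=
    .of_forall fun N j => boxAverage_eq_one (hER.dualPairing_eq_one hE) ⟨j, self_mem_box N j⟩
      (box_finite hα N j)
  have upper_E : upperMeasure 𝕜 α id E = 1 := upperLim_eq_of_eventually_eq average_E
  have one_le : 1 ≤ lowerDensity α a := hlim.one_le_lowerLim average_E hF.upperMeasure_le_one
  refine ⟨hlim.pLim_eq_one_div average_E, hlim.lowerLim_eq_one_div average_E,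
    hlim.upperLim_eq_one_div average_E, one_le, fun hlt => removable (upper_E.trans_lt hlt),
    fun hFR => ?_⟩
  obtain ⟨K, hK⟩ := exists_encard_fiber_le hα hD
  have average_F := eventually_boxAverage_eq_one (hFR.dualPairing_eq_one hF) (preBox_finite hα hK)
    (zero_lt_one.trans_le one_le).ne'
  exact ⟨hlim.lowerLim_eq_one average_E average_F, hlim.upperLim_eq_one average_E average_F,
    lowerLim_eq_of_eventually_eq average_F, upperLim_eq_of_eventually_eq average_F, fun p c hp =>
      ⟨hlim.pLim_eq_one average_E average_F hp, pLim_eq_of_eventually_eq average_F hp⟩⟩
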